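/- Let $\mathbf D$ be an infinite set of atomic values and $\mathbf X$ a set of variables, whose elements are written as bit strings by fixed injective encodings. Fix a relational schema $\Sigma=(R_1[U_1],\dots,R_k[U_k])$ with finite nonempty attribute sets $U_i$. A (tuple-level) gWSD over $\Sigma$ is a pair $(\{C_1,\dots,C_m\},\phi)$. Here $\phi$ is a conjunction of possibly negated equalities between elements of $\mathbf D\cup\mathbf X$, and $C_1,\dots,C_m$ (the components) are finite non-nullary relations with entries in $\mathbf D\cup\mathbf X\cup\{\bot\}$. Their attribute sets are pairwise disjoint and consist of fields $R_i.d.A$ ($d$ a tuple identifier, $A\in U_i$), and whenever a component contains a field $R_i.d.A$, it contains all the fields $R_i.d.B$ with $B\in U_i$. A choice of one row from every component and of a valuation $\nu:\mathbf X\to\mathbf D$ satisfying $\phi$ defines a possible world: the database over $\Sigma$ in which $R_i$ consists of the tuples $\nu(t_d)$, where $d$ ranges over the tuple identifiers of $R_i$ for which the tuple $t_d$ of the chosen entries in the fields $R_i.d.A$, $A\in U_i$, contains no $\bot$. The set of all these worlds is $rep(\mathcal W)$. Positive relational algebra queries over $\Sigma$ are built from the relations $R_i$ by selection with conditions that are negation-free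 Boolean combinations of equalities $A=B$ and $A=c$ ($A,B$ attributes, $c\in\mathbf D$), projection, product, union and renaming. **Theorem.** (1) For every fixed positive relational algebra query $q$ over $\Sigma$, tuple $q$-possibility is in PTIME for gWSDs: the problem to decide, given a gWSD $\mathcal W$ over $\Sigma$ and a tuple $t$ over $\mathbf D$ with the attributes of the answer of $q$, whether there is a world $\mathcal A\in rep(\mathcal W)$ with $t\in q(\mathcal A)$, is solved by a deterministic Turing machine in time polynomial in the length of the input $(\mathcal W,t)$, written as a word over a finite alphabet (rows of components, conditions and values listed explicitly, numbers in binary). (2) In particular, for every relation $R_i$ of $\Sigma$, tuple possibility is in PTIME for gWSDs: given a gWSD $\mathcal W$ over $\Sigma$ and a tuple $t$ over $\mathbf D$ with attribute set $U_i$, it can be decided in the same sense in polynomial time whether there is a world $\mathcal A\in rep(\mathcal W)$ with $t\in R_i^{\mathcal A}$. -/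

import Mathlib

namespace IncompleteDB

/-! ### Relational schemas, databases, positive relational algebra (named perspective) -/

/-- A relational schema `(R₁[U₁], …, R_k[U_k])`: relation names are the elements of
`Fin numRels`, attribute names are natural numbers, every `U_i` is finite and nonempty. -/
structure RelSchema where
  numRels : ℕ
  attrs : Fin numRels → Finset ℕ
  attrs_nonempty : ∀ i, (attrs i).Nonempty

/-- Tuples with entries in `V` over the attribute set `U`. -/
abbrev Tuple (V : Type) (U : Finset ℕ) : Type := U → V

/-- A database over the schema `S` with values in `D`: one relation per relation schema.
All databases below that are represented by a table or a decomposition are finite by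
construction. -/
abbrev Database (S : RelSchema) (D : Type) : Type :=
  (i : Fin S.numRels) → Set (Tuple D (S.attrs i))

/-- Positive selection conditions: Boolean combinations without negation of equalities
`A = B` and `A = c`. -/
inductive SelCond (D : Type) (U : Finset ℕ) : Type
  | top : SelCond D U
  | eqAttr (A B : U) : SelCond D U
  | eqConst (A : U) (c : D) : SelCond D U
  | and (p q : SelCond D U) : SelCond D U
  | or (p q : SelCond D U) : SelCond D U

def SelCond.Holds {D : Type} {U : Finset ℕ} : SelCond D U → Tuple D U → Prop
  | .top, _ => True
  | .eqAttr A B, t => t A = t B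
  | .eqConst A c, t => t A = c
  | .and p q, t => p.Holds t ∧ q.Holds t
  | .or p q, t => p.Holds t ∨ q.Holds t

/-- Positive relational algebra queries over the schema `S`, indexed by the attribute set of
the answer: selection with a positive condition, projection, product, union and renaming of
attributes (no difference). -/
inductive PosQuery (S : RelSchema) (D : Type) : Finset ℕ → Type
  | rel (i : Fin S.numRels) : PosQuery S D (S.attrs i)
  | select {U : Finset ℕ} (p : SelCond D U) (q : PosQuery S D U) : PosQuery S D U
  | project {U : Finset ℕ} (V : Finset ℕ) (h : V ⊆ U) (q : PosQuery S D U) : PosQuery S D V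
  | product {U V : Finset ℕ} (h : Disjoint U V) (q : PosQuery S D U) (r : PosQuery S D V) :
      PosQuery S D (U ∪ V)
  | union {U : Finset ℕ} (q r : PosQuery S D U) : PosQuery S D U
  | rename {U V : Finset ℕ} (f : U ≃ V) (q : PosQuery S D U) : PosQuery S D V

/-- The answer `q(A)` to the query `q` on the database `A`. -/
def PosQuery.eval {S : RelSchema} {D : Type} (A : Database S D) :
    {U : Finset ℕ} → PosQuery S D U → Set (Tuple D U)
  | _, .rel i => A i
  | _, .select p q => {t | t ∈ q.eval A ∧ p.Holds t}
  | _, .project _ h q => {t | ∃ s ∈ q.eval A, ∀ a, t a = s ⟨a.1, h a.2⟩}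
  | _, .product _ q r =>
      {t | (fun a => t ⟨a.1, Finset.mem_union_left _ a.2⟩) ∈ q.eval A ∧
           (fun a => t ⟨a.1, Finset.mem_union_right _ a.2⟩) ∈ r.eval A}
  | _, .union q r => q.eval A ∪ r.eval A
  | _, .rename f q => {t | (fun a => t (f a)) ∈ q.eval A}

/-! ### Conditions and g-multitables -/

/-- Elements of `D ∪ X`: domain values and variables. -/
inductive Term (D X : Type) : Type
  | const (c : D) : Term D X
  | var (x : X) : Term D X

/-- The extension of a valuation to `D ∪ X` by the identity on domain values. -/
def Term.eval {D X : Type} (ν : X → D) : Term D X → D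
  | .const c => c
  | .var x => ν x

/-- Possibly negated equalities over `D ∪ X`. -/
inductive Literal (D X : Type) : Type
  | eq (a b : Term D X) : Literal D X
  | ne (a b : Term D X) : Literal D X

def Literal.Holds {D X : Type} (ν : X → D) : Literal D X → Prop
  | .eq a b => a.eval ν = b.eval ν
  | .ne a b => a.eval ν ≠ b.eval ν

/-- A g-multitable: tables over `D ∪ X` and a global condition, the conjunction of a list of
possibly negated equalities. -/
structure GMultitable (S : RelSchema) (D X : Type) where
  table : (i : Fin S.numRels) → Set (Tuple (Term D X) (S.attrs i))
  cond : List (Literal D X)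

/-- The database `ν(T)`. -/
def GMultitable.apply {S : RelSchema} {D X : Type} (T : GMultitable S D X) (ν : X → D) :
    Database S D :=
  fun i => {t | ∃ s ∈ T.table i, t = fun a => (s a).eval ν}

/-- The set of possible worlds represented by a g-multitable. -/
def GMultitable.rep {S : RelSchema} {D X : Type} (T : GMultitable S D X) :
    Set (Database S D) :=
  {A | ∃ ν : X → D, (∀ l ∈ T.cond, l.Holds ν) ∧ A = T.apply ν}

/-! ### Tabset tables -/

/-- The attribute `R.d.A` of a tabset table: relation `R`, tuple identifier `d`, and an
attribute `A` of `R`. -/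
structure Field (S : RelSchema) where
  rel : Fin S.numRels
  tid : ℕ
  attr : S.attrs rel

/-- Entries of tabset tables: elements of `D ∪ X`, or `⊥` (which is `none`). -/
abbrev Cell (D X : Type) : Type := Option (Term D X)

/-- A g-tabset table with a single global condition. -/
structure GTST (S : RelSchema) (D X : Type) where
  schema : Set (Field S)
  table : Set (schema → Cell D X)
  cond : List (Literal D X)

/-- The inverse of inlining: the relation `R_i` receives, for each tuple identifier `d`, the
tuple of the fields `R_i.d.A`, unless one of these fields is `⊥`. -/
def inlineInv {S : RelSchema} {D X : Type} {F : Set (Field S)} (w : F → Cell D X)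
    (i : Fin S.numRels) : Set (Tuple (Term D X) (S.attrs i)) :=
  {s | ∃ (d : ℕ) (h : ∀ a : S.attrs i, (⟨i, d, a⟩ : Field S) ∈ F),
    ∀ a, w ⟨⟨i, d, a⟩, h a⟩ = some (s a)}

/-- The set of possible worlds represented by a g-tabset table. -/
def GTST.rep {S : RelSchema} {D X : Type} (T : GTST S D X) : Set (Database S D) :=
  ⋃ w ∈ T.table, (GMultitable.mk (inlineInv w) T.cond).rep

/-! ### World-set decompositions -/

/-- A component: a non-nullary relation, given by its distinct column names and the list of
its rows (the local worlds). -/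
structure Component (S : RelSchema) (D X : Type) where
  width : ℕ
  width_pos : 0 < width
  field : Fin width → Field S
  field_injective : Function.Injective field
  rows : List (Fin width → Cell D X)

def Component.schema {S : RelSchema} {D X : Type} (C : Component S D X) : Set (Field S) :=
  Set.range C.field

/-- Attribute-level gWSDs: components with pairwise disjoint schemas, together with a global
condition. With a field `R.d.A`, all fields `R.d.B` with `B` an attribute of `R` occur in the
union of the component schemas. -/
structure AttrGWSD (S : RelSchema) (D X : Type) where
  comps : List (Component S D X)
  cond : List (Literal D X)
  disjoint : comps.Pairwise fun C C' => Disjoint C.schema C'.schema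
  complete : ∀ (i : Fin S.numRels) (d : ℕ) (a b : S.attrs i),
    (∃ C ∈ comps, (⟨i, d, a⟩ : Field S) ∈ C.schema) →
    ∃ C ∈ comps, (⟨i, d, b⟩ : Field S) ∈ C.schema

/-- The g-tabset table `(C₁ × ⋯ × C_m, φ)` of which the gWSD is a decomposition. -/
def AttrGWSD.toGTST {S : RelSchema} {D X : Type} (W : AttrGWSD S D X) : GTST S D X where
  schema := {f | ∃ C ∈ W.comps, f ∈ C.schema}
  table := {w | ∀ (C : Component S D X) (hC : C ∈ W.comps), ∃ r ∈ C.rows,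
    ∀ j, w ⟨C.field j, C, hC, j, rfl⟩ = r j}
  cond := W.cond

/-- The set of possible worlds represented by a gWSD. -/
def AttrGWSD.rep {S : RelSchema} {D X : Type} (W : AttrGWSD S D X) : Set (Database S D) :=
  W.toGTST.rep

/-- (Tuple-level) gWSDs: the fields `R.d.A` and `R.d.B` of one tuple always lie in the same
component schema. -/
structure GWSD (S : RelSchema) (D X : Type) extends AttrGWSD S D X where
  tupleLevel : ∀ C ∈ comps, ∀ (i : Fin S.numRels) (d : ℕ) (a b : S.attrs i),
    (⟨i, d, a⟩ : Field S) ∈ C.schema → (⟨i, d, b⟩ : Field S) ∈ C.schema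

/-! ### Decision problems -/

/-- Tuple q-possibility: `t ∈ q(A)` for some world `A` represented by `W`. -/
def TupleQPossible {S : RelSchema} {D X : Type} {U : Finset ℕ} (q : PosQuery S D U)
    (W : GWSD S D X) (t : Tuple D U) : Prop :=
  ∃ A ∈ W.rep, t ∈ q.eval A

/-- Tuple possibility: `t ∈ R_i^A` for some world `A` represented by `W`. -/
def TuplePossible {S : RelSchema} {D X : Type} (i : Fin S.numRels)
    (W : GWSD S D X) (t : Tuple D (S.attrs i)) : Prop :=
  ∃ A ∈ W.rep, t ∈ A i

/-! ### Encoding of the input as a word over a finite alphabet -/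

/-- The input alphabet: two bits and the markers that start the parts of the input. -/
inductive Sym : Type
  | bit (b : Bool)
  | const | var | bot
  | rel | tid | attr
  | comp | row
  | cond | eq | ne
  | tuple

def encodeBits (l : List Bool) : List Sym := l.map Sym.bit

/-- Binary representation of natural numbers. -/
def encodeNum (n : ℕ) : List Sym := encodeBits (Computability.encodeNat n)

section Encoding

variable {S : RelSchema} {D X : Type} (encD : D → List Bool) (encX : X → List Bool)

def encodeTerm : Term D X → List Sym
  | .const c => Sym.const :: encodeBits (encD c)
  | .var x => Sym.var :: encodeBits (encX x)

def encodeCell : Cell D X → List Sym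
  | none => [Sym.bot]
  | some a => encodeTerm encD encX a

def encodeLiteral : Literal D X → List Sym
  | .eq a b => Sym.eq :: (encodeTerm encD encX a ++ encodeTerm encD encX b)
  | .ne a b => Sym.ne :: (encodeTerm encD encX a ++ encodeTerm encD encX b)

def encodeField (f : Field S) : List Sym :=
  Sym.rel :: encodeNum f.rel ++ Sym.tid :: encodeNum f.tid ++ Sym.attr :: encodeNum f.attr

/-- The header of the component, then its rows. -/
def encodeComponent (C : Component S D X) : List Sym :=
  Sym.comp :: (List.ofFn fun j => encodeField (C.field j)).flatten ++
    C.rows.flatMap fun r => Sym.row :: (List.ofFn fun j => encodeCell encD encX (r j)).flatten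

def encodeGWSD (W : GWSD S D X) : List Sym :=
  W.comps.flatMap (encodeComponent encD encX) ++
    Sym.cond :: W.cond.flatMap (encodeLiteral encD encX)

/-- The values of the tuple, in increasing order of the attribute names. -/
def encodeTuple {U : Finset ℕ} (t : Tuple D U) : List Sym :=
  Sym.tuple :: (List.ofFn fun j : Fin U.card =>
    Sym.const :: encodeBits (encD (t (U.orderIsoOfFin rfl j)))).flatten

/-- The input word for the pair of a gWSD and a tuple. -/
def encodeInput {U : Finset ℕ} (p : GWSD S D X × Tuple D U) : List Sym :=
  encodeGWSD encD encX p.1 ++ encodeTuple encD p.2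

end Encoding

/-- The decision problem `P`, on inputs of type `α` that are written as words by `e`, is in
PTIME: its characteristic function is computed by a Turing machine in time polynomial in the
length of the input word. -/
def InPTIME {α Γ : Type} (e : α → List Γ) (P : α → Prop) : Prop :=
  ∃ f : α → Bool, (∀ a, f a = true ↔ P a) ∧
    Nonempty (Turing.TM2ComputableInPolyTime e Computability.encodeBool f)

end IncompleteDB

open IncompleteDB

/-! A derivation of `t ∈ q(A)` for a positive query uses a number of base tuples that depends on `q`
only. For fixed `q`, polynomially many symbolic answers (`sols`) therefore suffice: each consists of
a tuple of terms, a list of entries that the chosen rows must have, and a list of equalities that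
the valuation must satisfy. Positivity makes membership in the answer an existential statement over
them (`mem_eval_iff`). At the leaves a symbolic tuple is read off a single row, because in a
tuple-level gWSD all fields of a tuple lie in one component (`mem_worldDB_iff`).

For one symbolic answer the choice of rows and the valuation are constrained separately. Components
have disjoint schemas, so the required entries are attainable iff each component on its own has a
fitting row and every required field exists (`exists_picks_iff`). The valuation must satisfy the
condition, the collected equalities and the identification with `t`. Over an infinite domain such a
conjunction is satisfiable iff its equalities force neither a negated equality nor the identity of
two distinct constants, which is decided by eliminating the equalities through substitution
(`separable_iff`, `sat_iff`). Together this gives `decideRaw_iff`.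

The time bound is proved on actual machines. Flowcharts over stacks compile to `TM2` machines
(`Exec.toTM`); data are binary trees in a prefix code on one stack. The predicate `Poly` is closed
under composition, pairing, case distinction and folds whose states stay polynomially small
(`Poly.comp`, `Poly.prodMk`, `Poly.listCases`, `Poly.foldlAux`), which yields `Poly.decideRaw`. A
finite-state parser (`Poly.parse`) turns the input word into exactly the tree that codes the gWSD
and the tuple, and `inPTIME_of_poly` adds loading of the input and output of the answer. -/

namespace StackFlow

/-! ### Flowcharts over stacks -/

/-- An instruction of a flowchart: jump, push a fixed symbol, or pop and dispatch. -/
inductive Instr {K : Type} (Γ : K → Type) (Λ : Type) : Type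
  | jump (l : Λ)
  | push (k : K) (s : Γ k) (l : Λ)
  | pop (k : K) (next : Option (Γ k) → Λ)

abbrev Store {K : Type} (Γ : K → Type) : Type := ∀ k, List (Γ k)

section Flow

variable {K : Type} {Γ : K → Type} {Λ Λ' : Type}

def Instr.map (g : Λ → Λ') : Instr Γ Λ → Instr Γ Λ'
  | .jump l => .jump (g l)
  | .push k s l => .push k s (g l)
  | .pop k next => .pop k fun o => g (next o)

def Instr.next : Instr Γ Λ → Store Γ → Λ
  | .jump l, _ => l
  | .push _ _ l, _ => l
  | .pop k next, S => next (S k).head?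

@[simp] theorem Instr.next_map (g : Λ → Λ') (i : Instr Γ Λ) (S : Store Γ) :
    (i.map g).next S = g (i.next S) := by
  cases i <;> rfl

variable [DecidableEq K]

def Instr.store : Instr Γ Λ → Store Γ → Store Γ
  | .jump _, S => S
  | .push k s _, S => Function.update S k (s :: S k)
  | .pop k _, S => Function.update S k (S k).tail

@[simp] theorem Instr.store_map (g : Λ → Λ') (i : Instr Γ Λ) (S : Store Γ) :
    (i.map g).store S = i.store S := by
  cases i <;> rfl

/-- `Exec code l S t l' S'`: from label `l` and store `S` the flowchart reaches label `l'` and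
store `S'` within `t` steps; the label `none` is the exit. -/
inductive Exec (code : Λ → Instr Γ (Option Λ)) :
    Option Λ → Store Γ → ℕ → Option Λ → Store Γ → Prop
  | refl (l : Option Λ) (S : Store Γ) (t : ℕ) : Exec code l S t l S
  | step {l : Λ} {S : Store Γ} {t : ℕ} {l' : Option Λ} {S' : Store Γ} :
      Exec code ((code l).next S) ((code l).store S) t l' S' → Exec code (some l) S (t + 1) l' S'

theorem Exec.mono {code : Λ → Instr Γ (Option Λ)} {l l' : Option Λ} {S S' : Store Γ} {t u : ℕ}
    (h : Exec code l S t l' S') (htu : t ≤ u) : Exec code l S u l' S' := by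
  induction h generalizing u with
  | refl => exact .refl _ _ _
  | step _ ih =>
    obtain ⟨v, rfl⟩ : ∃ v, u = v + 1 := ⟨u - 1, by omega⟩
    exact .step (ih (by omega))

theorem Exec.trans {code : Λ → Instr Γ (Option Λ)} {l l' l'' : Option Λ} {S S' S'' : Store Γ}
    {t u : ℕ} (h : Exec code l S t l' S') (h' : Exec code l' S' u l'' S'') :
    Exec code l S (t + u) l'' S'' := by
  induction h with
  | refl => exact h'.mono (by omega)
  | step _ ih =>
    rw [add_right_comm]
    exact .step (ih h')

/-- Basis of all program composition: `code'` contains a copy of `code`, relabelled by `e`, whose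
exits are redirected to `x`, so runs transfer step by step. -/
theorem Exec.embed {code : Λ → Instr Γ (Option Λ)} {code' : Λ' → Instr Γ (Option Λ')}
    (e : Λ → Λ') (x : Option Λ')
    (he : ∀ l, code' (e l) = (code l).map fun o => o.elim x fun l => some (e l))
    {l l' : Option Λ} {S S' : Store Γ} {t : ℕ} (h : Exec code l S t l' S') :
    Exec code' (l.elim x fun l => some (e l)) S t (l'.elim x fun l => some (e l)) S' := by
  induction h with
  | refl => exact .refl _ _ _
  | step _ ih =>
    refine .step ?_
    rwa [he, Instr.next_map, Instr.store_map]

structure Flow {K : Type} (Γ : K → Type) where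
  Λ : Type
  [fin : Fintype Λ]
  start : Λ
  code : Λ → Instr Γ (Option Λ)

attribute [instance] Flow.fin

/-- The flowchart `F` transforms the store `S` into `S'` within `t` steps. -/
def Flow.Run (F : Flow Γ) (S : Store Γ) (t : ℕ) (S' : Store Γ) : Prop :=
  Exec F.code (some F.start) S t none S'

theorem Flow.Run.mono {F : Flow Γ} {S S' : Store Γ} {t u : ℕ} (h : F.Run S t S') (htu : t ≤ u) :
    F.Run S u S' :=
  Exec.mono h htu

theorem Flow.Run.congr {F : Flow Γ} {S S' S'' : Store Γ} {t u : ℕ} (h : F.Run S t S')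
    (htu : t ≤ u) (hS : S' = S'') : F.Run S u S'' :=
  hS ▸ h.mono htu

def Flow.skip {K : Type} (Γ : K → Type) : Flow Γ where
  Λ := Unit
  start := ()
  code _ := .jump none

theorem Flow.skip_run (S : Store Γ) : (Flow.skip Γ).Run S 1 S :=
  .step (.refl _ _ _)

def Flow.push (k : K) (s : Γ k) : Flow Γ where
  Λ := Unit
  start := ()
  code _ := .push k s none

theorem Flow.push_run (k : K) (s : Γ k) (S : Store Γ) :
    (Flow.push k s).Run S 1 (Function.update S k (s :: S k)) :=
  .step (.refl _ _ _)

def Flow.seq (F G : Flow Γ) : Flow Γ where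
  Λ := F.Λ ⊕ G.Λ
  start := .inl F.start
  code
    | .inl l => (F.code l).map fun o => o.elim (some (.inr G.start)) fun l => some (.inl l)
    | .inr l => (G.code l).map fun o => o.elim none fun l => some (.inr l)

theorem Flow.Run.seq {F G : Flow Γ} {S S' S'' : Store Γ} {t u : ℕ} (h : F.Run S t S')
    (h' : G.Run S' u S'') : (F.seq G).Run S (t + u) S'' :=
  (Exec.embed (code' := (F.seq G).code) Sum.inl (some (.inr G.start)) (fun _ => rfl) h).trans
    (Exec.embed (code' := (F.seq G).code) Sum.inr none (fun _ => rfl) h')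

open Turing

/-- The statement of a Turing machine for an instruction: the internal state is the next label. -/
def Instr.toStmt : Instr Γ (Option Λ) → Λ → TM2.Stmt Γ Λ (Option Λ)
  | .jump o, l => .load (fun _ => o) (.branch Option.isSome (.goto fun v => v.getD l) .halt)
  | .push k s o, l =>
    .push k (fun _ => s) (.load (fun _ => o) (.branch Option.isSome (.goto fun v => v.getD l) .halt))
  | .pop k next, l =>
    .pop k (fun _ o => next o) (.branch Option.isSome (.goto fun v => v.getD l) .halt)

/-- A popped symbol can influence the next label only through the internal state, hence the state
holds that label. One machine step is then exactly one instruction. -/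
theorem Instr.stepAux_toStmt (i : Instr Γ (Option Λ)) (l : Λ) (v : Option Λ) (S : Store Γ) :
    TM2.stepAux (i.toStmt l) v S = ⟨i.next S, i.next S, i.store S⟩ := by
  cases i with
  | jump o => cases o <;> rfl
  | push k s o => cases o <;> rfl
  | pop k next =>
    simp only [toStmt, Instr.next, Instr.store, TM2.stepAux]
    cases h : next (S k).head? <;> rfl

variable [∀ k, Fintype (Γ k)]

/-- Pop stack `k` and continue according to the popped symbol. -/
def Flow.branch (k : K) (body : Option (Γ k) → Flow Γ) : Flow Γ where
  Λ := Option (Σ o, (body o).Λ)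
  start := none
  code
    | none => .pop k fun o => some (some ⟨o, (body o).start⟩)
    | some ⟨o, l⟩ => ((body o).code l).map fun o' => o'.elim none fun l => some (some ⟨o, l⟩)

theorem Flow.Run.branch {k : K} {body : Option (Γ k) → Flow Γ} {S S' : Store Γ} {t : ℕ}
    (h : (body (S k).head?).Run (Function.update S k (S k).tail) t S') :
    (Flow.branch k body).Run S (t + 1) S' :=
  .step (Exec.embed (code' := (Flow.branch k body).code) (fun l => some ⟨_, l⟩) none
    (fun _ => rfl) h)

/-- Pop stack `k` repeatedly, running the body as long as the popped symbol satisfies `c`. -/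
def Flow.loop (k : K) (c : Option (Γ k) → Bool) (body : Option (Γ k) → Flow Γ) : Flow Γ where
  Λ := Option (Σ o, (body o).Λ)
  start := none
  code
    | none => .pop k fun o => if c o then some (some ⟨o, (body o).start⟩) else none
    | some ⟨o, l⟩ => ((body o).code l).map fun o' => o'.elim (some none) fun l => some (some ⟨o, l⟩)

/-- The symbol that stops the loop is consumed as well; programs that walk along a list code rely on
this to remove its terminating leaf. -/
theorem Flow.loop_exit {k : K} {c : Option (Γ k) → Bool} {body : Option (Γ k) → Flow Γ}
    {S : Store Γ} (h : c (S k).head? = false) :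
    (Flow.loop k c body).Run S 1 (Function.update S k (S k).tail) := by
  refine .step ?_
  simp only [Flow.loop, Instr.next, Instr.store, h]
  exact .refl _ _ _

theorem Flow.Run.loop {k : K} {c : Option (Γ k) → Bool} {body : Option (Γ k) → Flow Γ}
    {S S' S'' : Store Γ} {t u : ℕ} (hc : c (S k).head? = true)
    (h : (body (S k).head?).Run (Function.update S k (S k).tail) t S')
    (h' : (Flow.loop k c body).Run S' u S'') : (Flow.loop k c body).Run S (t + u + 1) S'' := by
  refine .step (Exec.trans (S' := S') (l' := some none) ?_ h')
  have := Exec.embed (code' := (Flow.loop k c body).code) (fun l => some ⟨_, l⟩) (some none)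
    (fun _ => rfl) h
  simpa [Flow.loop, Instr.next, Instr.store, hc] using this

@[reducible] def Flow.toTM (F : Flow Γ) [Fintype K] (k₀ k₁ : K) : FinTM2 where
  K := K
  k₀ := k₀
  k₁ := k₁
  Γ := Γ
  Λ := F.Λ
  main := F.start
  σ := Option F.Λ
  initialState := none
  m l := (F.code l).toStmt l

/-- After each step the internal state equals the label just reached. On halting it is therefore
`none`, the initial state, as the halting configuration of a `FinTM2` requires. -/
theorem Exec.toTM (F : Flow Γ) [Fintype K] (k₀ k₁ : K) {l l' : Option F.Λ} {S S' : Store Γ} {t : ℕ}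
    (h : Exec F.code l S t l' S') (hl' : l' = none) (v : Option F.Λ) (hv : l = none → v = none) :
    ∃ n ≤ t, (flip bind (F.toTM k₀ k₁).step)^[n] (some (⟨l, v, S⟩ : TM2.Cfg Γ F.Λ (Option F.Λ))) =
      some (⟨none, none, S'⟩ : TM2.Cfg Γ F.Λ (Option F.Λ)) := by
  induction h generalizing v with
  | refl l S t =>
    subst hl'
    obtain rfl := hv rfl
    exact ⟨0, by omega, rfl⟩
  | @step l S t l' S' _ ih =>
    obtain ⟨n, hn, h⟩ := ih hl' ((F.code l).next S) id
    refine ⟨n + 1, by omega, ?_⟩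
    rw [Function.iterate_succ_apply, ← h]
    congr 1
    exact congrArg some ((F.code l).stepAux_toStmt l v S)

end Flow

/-! ### Binary trees on a stack -/

inductive Dat : Type
  | nil
  | node (a b : Dat)

/-- A prefix code for binary trees. -/
def Dat.enc : Dat → List Bool
  | .nil => [false]
  | .node a b => true :: (a.enc ++ b.enc)

def Dat.size : Dat → ℕ
  | .nil => 1
  | .node a b => a.size + b.size + 1

@[simp] theorem Dat.length_enc (d : Dat) : d.enc.length = d.size := by
  induction d with
  | nil => rfl
  | node a b iha ihb => simp [enc, size, iha, ihb]

theorem Dat.size_pos (d : Dat) : 0 < d.size := by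
  cases d <;> simp [size]

/-- The code is self-delimiting: a tree can be split off from whatever lies below it on the stack.
-/
theorem Dat.enc_append_inj {d d' : Dat} {r r' : List Bool} (h : d.enc ++ r = d'.enc ++ r') :
    d = d' ∧ r = r' := by
  induction d generalizing d' r r' with
  | nil => cases d' <;> simp_all [enc]
  | node a b iha ihb =>
    cases d' with
    | nil => simp [enc] at h
    | node a' b' =>
      simp only [enc, List.cons_append, List.append_assoc, List.cons.injEq, true_and] at h
      obtain ⟨rfl, h₁⟩ := iha h
      obtain ⟨rfl, h₂⟩ := ihb h₁
      exact ⟨rfl, h₂⟩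

theorem Dat.enc_injective : Function.Injective Dat.enc := fun d d' h =>
  (Dat.enc_append_inj (r := []) (r' := []) (by simpa using h)).1

/-- The working stacks: the main stack, two auxiliary stacks, and a counter. -/
inductive Reg : Type
  | main
  | aux (k : Bool)
  | cnt
  deriving DecidableEq, Fintype

/-- The input stack has alphabet `Γ₀`, the working stacks have alphabet `Bool`. -/
@[reducible] def Alph (Γ₀ : Type) : Option Reg → Type
  | none => Γ₀
  | some _ => Bool

instance Alph.fintype (Γ₀ : Type) [Fintype Γ₀] : ∀ k, Fintype (Alph Γ₀ k)
  | none => inferInstanceAs (Fintype Γ₀)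
  | some _ => inferInstanceAs (Fintype Bool)

/-! ### Stack programs that move, drop, copy, swap and compare trees. -/

section Programs

variable {Γ₀ : Type}

/-- The store with contents `x` of the auxiliary stack `k`, and `y` of the other one. -/
def st (i : List Γ₀) (k : Bool) (m x y c : List Bool) : Store (Alph Γ₀)
  | none => i
  | some .main => m
  | some (.aux k') => if k' = k then x else y
  | some .cnt => c

variable {i : List Γ₀} {k : Bool} {m x y c : List Bool}

@[simp] theorem st_inp : st i k m x y c none = i := rfl

@[simp] theorem st_main : st i k m x y c (some .main) = m := rfl

@[simp] theorem st_cnt : st i k m x y c (some .cnt) = c := rfl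

@[simp] theorem st_aux : st i k m x y c (some (.aux k)) = x := by simp [st]

/-- Exchanges the roles of the two auxiliary stacks, so that each program is analysed for one of
them only. -/
theorem st_not : st i (!k) m y x c = st i k m x y c := by
  funext j
  rcases j with _ | _ | k' | _ <;> try rfl
  cases k <;> cases k' <;> rfl

@[simp] theorem update_st_inp (l : List Γ₀) :
    Function.update (st i k m x y c) none l = st l k m x y c := by
  funext j
  rcases j with _ | _ | k' | _ <;> simp [Function.update, st]

@[simp] theorem update_st_main (l : List Bool) :
    Function.update (st i k m x y c) (some .main) l = st i k l x y c := by
  funext j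
  rcases j with _ | _ | k' | _ <;> simp [Function.update, st]

@[simp] theorem update_st_cnt (l : List Bool) :
    Function.update (st i k m x y c) (some .cnt) l = st i k m x y l := by
  funext j
  rcases j with _ | _ | k' | _ <;> simp [Function.update, st]

@[simp] theorem update_st_aux (l : List Bool) :
    Function.update (st i k m x y c) (some (.aux k)) l = st i k m l y c := by
  funext j
  rcases j with _ | _ | k' | _ <;> try simp [Function.update, st]; done
  by_cases h : k' = k
  · subst h; simp
  · simp [Function.update, st, h]

theorem push_main_run (s : Bool) :
    (Flow.push (Γ := Alph Γ₀) (some .main) s).Run (st i k m x y c) 1 (st i k (s :: m) x y c) := by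
  simpa using Flow.push_run (Γ := Alph Γ₀) (some .main) s (st i k m x y c)

theorem push_cnt_run (s : Bool) :
    (Flow.push (Γ := Alph Γ₀) (some .cnt) s).Run (st i k m x y c) 1 (st i k m x y (s :: c)) := by
  simpa using Flow.push_run (Γ := Alph Γ₀) (some .cnt) s (st i k m x y c)

theorem push_aux_run (s : Bool) :
    (Flow.push (Γ := Alph Γ₀) (some (.aux k)) s).Run (st i k m x y c) 1
      (st i k m (s :: x) y c) := by
  simpa using Flow.push_run (Γ := Alph Γ₀) (some (.aux k)) s (st i k m x y c)

theorem push_aux_not_run (s : Bool) :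
    (Flow.push (Γ := Alph Γ₀) (some (.aux !k)) s).Run (st i k m x y c) 1
      (st i k m x (s :: y) c) := by
  rw [← st_not, ← st_not (k := k)]
  exact push_aux_run s

/-- The store whose main stack is `m`, all other stacks being empty. -/
def ready (Γ₀ : Type) (m : List Bool) : Store (Alph Γ₀) :=
  st [] true m [] [] []

theorem ready_eq : ready Γ₀ m = st [] k m [] [] [] := by
  cases k
  · exact (st_not (k := true)).symm
  · rfl

def pushBits {Γ₀ : Type} : List Bool → Flow (Alph Γ₀)
  | [] => Flow.skip _
  | b :: l => (pushBits l).seq (Flow.push (Γ := Alph Γ₀) (some .main) b)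

theorem pushBits_run (l : List Bool) :
    (pushBits l).Run (st i k m x y c) (l.length + 1) (st i k (l ++ m) x y c) := by
  induction l with
  | nil => exact Flow.skip_run _
  | cons b l ih => exact ih.seq (push_main_run b)

variable [Fintype Γ₀]

theorem branch_main_run {body : Option Bool → Flow (Alph Γ₀)} {b : Bool} {t : ℕ}
    {S : Store (Alph Γ₀)} (h : (body (some b)).Run (st i k m x y c) t S) :
    (Flow.branch (Γ := Alph Γ₀) (some .main) body).Run (st i k (b :: m) x y c) (t + 1) S :=
  Flow.Run.branch (by simpa using h)

/-- The loop of `scan`. -/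
def scanLoop (Γ₀ : Type) [Fintype Γ₀] (k : Bool) : Flow (Alph Γ₀) :=
  Flow.loop (Γ := Alph Γ₀) (some .cnt) Option.isSome fun _ =>
    Flow.branch (Γ := Alph Γ₀) (some .main) fun
      | some true => (Flow.push (Γ := Alph Γ₀) (some (.aux k)) true).seq
          ((Flow.push (Γ := Alph Γ₀) (some .cnt) true).seq
            (Flow.push (Γ := Alph Γ₀) (some .cnt) true))
      | some false => Flow.push (Γ := Alph Γ₀) (some (.aux k)) false
      | none => Flow.skip _

/-- Move the tree on top of the main stack to the auxiliary stack `k`, in reverse. -/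
def scan (Γ₀ : Type) [Fintype Γ₀] (k : Bool) : Flow (Alph Γ₀) :=
  (Flow.push (Γ := Alph Γ₀) (some .cnt) true).seq (scanLoop Γ₀ k)

/-- The counter holds one mark for each subtree still to be read: a leaf uses up a mark, an inner
node replaces its mark by two. Stating the result relative to a continuation run `h` lets the
induction chain the two subtrees. Each symbol costs at most five steps. -/
theorem scanLoop_run (d : Dat) {r : List Bool} {u : ℕ} {b : Bool} {S : Store (Alph Γ₀)}
    (h : (scanLoop Γ₀ k).Run (st i k r (d.enc.reverse ++ x) y c) u S) :
    (scanLoop Γ₀ k).Run (st i k (d.enc ++ r) x y (b :: c)) (u + 5 * d.size) S := by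
  induction d generalizing r u b x c with
  | nil =>
    refine Flow.Run.mono (Flow.Run.loop (t := 1 + 1) (by simp) ?_ h)
      (by simp only [Dat.size]; omega)
    simp only [Dat.enc, st_cnt, List.tail_cons, update_st_cnt, List.cons_append, List.nil_append,
      List.reverse_cons, List.reverse_nil]
    exact branch_main_run (push_aux_run false)
  | node d₁ d₂ ih₁ ih₂ =>
    have h₂ := ih₁ (b := true) (c := true :: c) (x := true :: x) (ih₂ (b := true) (by
      simpa [Dat.enc] using h))
    refine Flow.Run.mono (Flow.Run.loop (t := (1 + (1 + 1)) + 1) (by simp) ?_ h₂)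
      (by simp only [Dat.size]; omega)
    simp only [Dat.enc, st_cnt, List.tail_cons, update_st_cnt, List.cons_append,
      List.append_assoc]
    exact branch_main_run ((push_aux_run true).seq ((push_cnt_run true).seq (push_cnt_run true)))

theorem scan_run (d : Dat) {r : List Bool} :
    (scan Γ₀ k).Run (st i k (d.enc ++ r) x y []) (5 * d.size + 2)
      (st i k r (d.enc.reverse ++ x) y []) := by
  refine ((push_cnt_run true).seq (scanLoop_run d (u := 1) ?_)).mono (by omega)
  exact (Flow.loop_exit (by simp)).congr le_rfl (by simp)

/-- Empty the auxiliary stack `k`, running the program `body` on every symbol. -/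
def pour (k : Bool) (body : Bool → Flow (Alph Γ₀)) : Flow (Alph Γ₀) :=
  Flow.loop (Γ := Alph Γ₀) (some (.aux k)) Option.isSome fun o => o.elim (Flow.skip _) body

theorem pour_nil_run {body : Bool → Flow (Alph Γ₀)} :
    (pour k body).Run (st i k m [] y c) 1 (st i k m [] y c) := by
  exact (Flow.loop_exit (by simp)).congr le_rfl (by simp)

theorem pour_cons_run {body : Bool → Flow (Alph Γ₀)} {b : Bool} {t u : ℕ} {S S' : Store (Alph Γ₀)}
    (h : (body b).Run (st i k m x y c) t S) (h' : (pour k body).Run S u S') :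
    (pour k body).Run (st i k m (b :: x) y c) (t + u + 1) S' :=
  Flow.Run.loop (by simp) (by simpa using h) h'

theorem pour_main_run :
    (pour k fun b => Flow.push (Γ := Alph Γ₀) (some .main) b).Run (st i k m x y c)
      (2 * x.length + 1) (st i k (x.reverse ++ m) [] y c) := by
  induction x generalizing m with
  | nil => exact pour_nil_run
  | cons b x ih =>
    exact (pour_cons_run (push_main_run b) ih).congr (by simp; omega) (by simp)

theorem pour_aux_run :
    (pour k fun b => Flow.push (Γ := Alph Γ₀) (some (.aux !k)) b).Run (st i k m x y c)
      (2 * x.length + 1) (st i k m [] (x.reverse ++ y) c) := by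
  induction x generalizing y with
  | nil => exact pour_nil_run
  | cons b x ih =>
    exact (pour_cons_run (push_aux_not_run b) ih).congr (by simp; omega) (by simp)

theorem pour_both_run :
    (pour k fun b => (Flow.push (Γ := Alph Γ₀) (some .main) b).seq
      (Flow.push (Γ := Alph Γ₀) (some (.aux !k)) b)).Run (st i k m x y c)
      (3 * x.length + 1) (st i k (x.reverse ++ m) [] (x.reverse ++ y) c) := by
  induction x generalizing m y with
  | nil => exact pour_nil_run
  | cons b x ih =>
    exact (pour_cons_run ((push_main_run b).seq (push_aux_not_run b)) ih).congr (by simp; omega) (by simp)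

theorem pour_skip_run :
    (pour k fun _ => Flow.skip (Alph Γ₀)).Run (st i k m x y c)
      (2 * x.length + 1) (st i k m [] y c) := by
  induction x with
  | nil => exact pour_nil_run
  | cons b x ih =>
    exact Flow.Run.mono (pour_cons_run (Flow.skip_run _) ih) (by simp; omega)

def dropTop (Γ₀ : Type) [Fintype Γ₀] : Flow (Alph Γ₀) :=
  (scan Γ₀ true).seq (pour true fun _ => Flow.skip (Alph Γ₀))

theorem dropTop_run (d : Dat) {r : List Bool} :
    (dropTop Γ₀).Run (ready Γ₀ (d.enc ++ r)) (7 * d.size + 3) (ready Γ₀ r) :=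
  ((scan_run d).seq pour_skip_run).mono (by simp; omega)

def dup (Γ₀ : Type) [Fintype Γ₀] : Flow (Alph Γ₀) :=
  (scan Γ₀ true).seq
    ((pour true fun b => (Flow.push (Γ := Alph Γ₀) (some .main) b).seq
      (Flow.push (Γ := Alph Γ₀) (some (.aux !true)) b)).seq
    ((pour false fun b => Flow.push (Γ := Alph Γ₀) (some (.aux !false)) b).seq
    (pour true fun b => Flow.push (Γ := Alph Γ₀) (some .main) b)))

theorem dup_run (d : Dat) {r : List Bool} :
    (dup Γ₀).Run (ready Γ₀ (d.enc ++ r)) (12 * d.size + 5) (ready Γ₀ (d.enc ++ (d.enc ++ r))) := by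
  have h₁ := scan_run (Γ₀ := Γ₀) (i := []) (k := true) (x := []) (y := []) d (r := r)
  have h₂ := pour_both_run (Γ₀ := Γ₀) (i := []) (k := true) (x := d.enc.reverse ++ []) (y := [])
    (m := r) (c := [])
  rw [← st_not (x := [])] at h₂
  have h₃ := pour_aux_run (Γ₀ := Γ₀) (i := []) (k := false) (y := [])
    (x := (d.enc.reverse ++ []).reverse ++ []) (m := (d.enc.reverse ++ []).reverse ++ r) (c := [])
  rw [← st_not (x := [])] at h₃
  have h₄ := pour_main_run (Γ₀ := Γ₀) (i := []) (k := true) (y := [])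
    (x := ((d.enc.reverse ++ []).reverse ++ []).reverse ++ [])
    (m := (d.enc.reverse ++ []).reverse ++ r) (c := [])
  exact Flow.Run.congr (h₁.seq (h₂.seq (h₃.seq h₄))) (by simp; omega) (by simp [ready])

def swapTop (Γ₀ : Type) [Fintype Γ₀] : Flow (Alph Γ₀) :=
  (scan Γ₀ true).seq ((scan Γ₀ false).seq
    ((pour true fun b => Flow.push (Γ := Alph Γ₀) (some .main) b).seq
    (pour false fun b => Flow.push (Γ := Alph Γ₀) (some .main) b)))

theorem swapTop_run (d d' : Dat) {r : List Bool} :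
    (swapTop Γ₀).Run (ready Γ₀ (d.enc ++ (d'.enc ++ r))) (7 * d.size + 7 * d'.size + 6)
      (ready Γ₀ (d'.enc ++ (d.enc ++ r))) := by
  have h₁ := scan_run (Γ₀ := Γ₀) (i := []) (k := true) (x := []) (y := []) d (r := d'.enc ++ r)
  rw [← st_not (x := _ ++ [])] at h₁
  have h₂ := scan_run (Γ₀ := Γ₀) (i := []) (k := false) (x := []) (y := d.enc.reverse ++ []) d'
    (r := r)
  rw [← st_not (x := _ ++ [])] at h₂
  have h₃ := pour_main_run (Γ₀ := Γ₀) (i := []) (k := true) (y := d'.enc.reverse ++ [])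
    (x := d.enc.reverse ++ []) (m := r) (c := [])
  rw [← st_not (x := [])] at h₃
  have h₄ := pour_main_run (Γ₀ := Γ₀) (i := []) (k := false) (x := d'.enc.reverse ++ [])
    (y := []) (m := (d.enc.reverse ++ []).reverse ++ r) (c := [])
  exact Flow.Run.congr (h₁.seq (h₂.seq (h₃.seq h₄))) (by simp; omega) (by simp [ready_eq (k := false)])

/-- Compare the auxiliary stacks symbol by symbol; every difference leaves a mark on the counter
stack. -/
def compareLoop (Γ₀ : Type) [Fintype Γ₀] : Flow (Alph Γ₀) :=
  pour true fun b => Flow.branch (Γ := Alph Γ₀) (some (.aux false)) fun o =>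
    if o = some b then Flow.skip _ else Flow.push (Γ := Alph Γ₀) (some .cnt) true

/-- A mismatch, or an exhausted second stack, leaves a mark in `c'`; a surplus of the second stack
survives in `y'`. Hence equality holds iff both end up empty. -/
theorem compareLoop_run : ∃ y' c', (compareLoop Γ₀).Run (st i true m x y c) (3 * x.length + 1)
      (st i true m [] y' c') ∧ y'.length ≤ y.length ∧ c'.length ≤ c.length + x.length ∧
      (y' = [] ∧ c' = [] ↔ x = y ∧ c = []) := by
  induction x generalizing y c with
  | nil => exact ⟨y, c, pour_nil_run, le_rfl, by simp, by simp [eq_comm]⟩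
  | cons b x ih =>
    have hb : ∀ {t S'}, ((fun o : Option Bool => if o = some b then Flow.skip (Alph Γ₀)
        else Flow.push (Γ := Alph Γ₀) (some .cnt) true) y.head?).Run
          (st i true m x y.tail c) t S' →
        (Flow.branch (Γ := Alph Γ₀) (some (.aux false)) fun o =>
          if o = some b then Flow.skip _ else Flow.push (Γ := Alph Γ₀) (some .cnt) true).Run
          (st i true m x y c) (t + 1) S' := by
      intro t S' h
      refine Flow.Run.branch ?_
      have e : st i true m x y c = st i false m y x c := st_not (k := false)
      have e' : st i true m x y.tail c = st i false m y.tail x c := st_not (k := false)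
      rw [e, update_st_aux, st_aux, ← e']
      exact h
    by_cases h : y.head? = some b
    · obtain ⟨y', c', hr, hy, hc, hiff⟩ := ih (y := y.tail) (c := c)
      refine ⟨y', c', (pour_cons_run (hb (t := 1) (S' := st i true m x y.tail c) ?_) hr).mono
        (by simp; omega), by simp at hy; omega, by simp; omega, ?_⟩
      · simp only [h, if_true]
        exact Flow.skip_run _
      · rw [hiff]
        cases y <;> simp_all
    · obtain ⟨y', c', hr, hy, hc, hiff⟩ := ih (y := y.tail) (c := true :: c)
      refine ⟨y', c', (pour_cons_run (hb (t := 1) (S' := st i true m x y.tail (true :: c)) ?_)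
        hr).mono (by simp; omega), by simp at hy; omega, by simp at hc ⊢; omega, ?_⟩
      · simp only [h, if_false]
        exact push_cnt_run true
      · rw [hiff]
        cases y <;> simp_all [eq_comm]

def drainCnt (Γ₀ : Type) [Fintype Γ₀] : Flow (Alph Γ₀) :=
  Flow.loop (Γ := Alph Γ₀) (some .cnt) Option.isSome fun _ => Flow.skip _

theorem drainCnt_run : (drainCnt Γ₀).Run (st i k m x y c) (2 * c.length + 1) (st i k m x y []) := by
  induction c with
  | nil =>
    exact (Flow.loop_exit (by simp)).congr le_rfl (by simp)
  | cons b c ih =>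
    exact (Flow.Run.loop (by simp) (Flow.skip_run _) (by rwa [st_cnt, update_st_cnt])).mono
      (by simp; omega)

/-- The codes of the truth values. -/
def Dat.ofBool : Bool → Dat
  | false => .nil
  | true => .node .nil .nil

/-- Replace the two topmost trees by the truth value of their equality. -/
def testEq (Γ₀ : Type) [Fintype Γ₀] : Flow (Alph Γ₀) :=
  (scan Γ₀ true).seq ((scan Γ₀ false).seq ((compareLoop Γ₀).seq
    ((pour false fun b => Flow.push (Γ := Alph Γ₀) (some .cnt) b).seq
      (Flow.branch (Γ := Alph Γ₀) (some .cnt) fun o =>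
        o.elim (pushBits (Dat.ofBool true).enc)
          fun _ => (drainCnt Γ₀).seq (pushBits (Dat.ofBool false).enc)))))

theorem pour_cnt_run :
    (pour k fun b => Flow.push (Γ := Alph Γ₀) (some .cnt) b).Run (st i k m x y c)
      (2 * x.length + 1) (st i k m [] y (x.reverse ++ c)) := by
  induction x generalizing c with
  | nil => exact pour_nil_run
  | cons b x ih =>
    exact (pour_cons_run (push_cnt_run b) ih).congr (by simp; omega) (by simp)

open Classical in
theorem testEq_run (d d' : Dat) {r : List Bool} :
    (testEq Γ₀).Run (ready Γ₀ (d.enc ++ (d'.enc ++ r))) (15 * d.size + 15 * d'.size + 20)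
      (ready Γ₀ ((Dat.ofBool (decide (d = d'))).enc ++ r)) := by
  have h₁ := scan_run (Γ₀ := Γ₀) (i := []) (k := true) (x := []) (y := []) d (r := d'.enc ++ r)
  rw [← st_not (x := _ ++ [])] at h₁
  have h₂ := scan_run (Γ₀ := Γ₀) (i := []) (k := false) (x := []) (y := d.enc.reverse ++ []) d'
    (r := r)
  rw [← st_not (x := _ ++ [])] at h₂
  obtain ⟨y', c', h₃, hy, hc, hiff⟩ := compareLoop_run (Γ₀ := Γ₀) (i := []) (m := r)
    (x := d.enc.reverse ++ []) (y := d'.enc.reverse ++ []) (c := [])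
  have h₄ := pour_cnt_run (Γ₀ := Γ₀) (i := []) (k := false) (x := y') (y := []) (m := r) (c := c')
  have e : st (Γ₀ := Γ₀) [] true r [] y' c' = st [] false r y' [] c' := st_not (k := false)
  rw [e] at h₃
  simp only [List.append_nil, List.length_reverse, Dat.length_enc, List.length_nil,
    zero_add] at hc hy hiff
  rw [List.reverse_inj, Dat.enc_injective.eq_iff] at hiff
  -- With the surplus `y'` poured onto the counter, a single emptiness test decides equality. The
  -- remaining marks must be drained before the answer is pushed.
  have h₅ : (Flow.branch (Γ := Alph Γ₀) (some .cnt) fun o =>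
        o.elim (pushBits (Dat.ofBool true).enc)
          fun _ => (drainCnt Γ₀).seq (pushBits (Dat.ofBool false).enc)).Run
        (st [] false r [] [] (y'.reverse ++ c')) (2 * d.size + 2 * d'.size + 7)
        (ready Γ₀ ((Dat.ofBool (decide (d = d'))).enc ++ r)) := by
    rw [ready_eq (k := false)]
    by_cases hd : d = d'
    · obtain ⟨rfl, rfl⟩ := hiff.2 (by simp [hd])
      refine (Flow.Run.branch (t := 4) ?_).mono (by omega)
      have h := (pushBits_run (Γ₀ := Γ₀) (i := []) (k := false) (m := r) (x := []) (y := [])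
        (c := []) (Dat.ofBool true).enc).mono (u := 4) (by simp [Dat.ofBool, Dat.size])
      rw [st_cnt, update_st_cnt]
      exact h.congr le_rfl (by simp [hd])
    · have hl : (y'.reverse ++ c').length ≤ d'.size + d.size := by simp; omega
      have hne : y'.reverse ++ c' ≠ [] := fun h => hd (hiff.1 (by simpa using h)).1
      generalize y'.reverse ++ c' = l at hl hne
      obtain ⟨b, l, rfl⟩ := List.exists_cons_of_ne_nil hne
      have h := (drainCnt_run (Γ₀ := Γ₀) (i := []) (k := false) (m := r) (x := []) (y := [])
        (c := l)).seq (pushBits_run (Dat.ofBool false).enc)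
      have h' := h.mono (u := 2 * d.size + 2 * d'.size + 6)
        (by simp [Dat.ofBool, Dat.size] at hl ⊢; omega)
      refine (Flow.Run.branch (t := 2 * d.size + 2 * d'.size + 6) ?_).mono le_rfl
      rw [st_cnt, update_st_cnt]
      exact h'.congr le_rfl (by simp [hd])
  refine Flow.Run.mono (h₁.seq (h₂.seq (h₃.seq (h₄.seq h₅)))) (by simp; omega)

end Programs

/-! ### Functions computable in polynomial time on coded data -/

/-- Injectivity is kept apart, in `CodeInj`, since only equality tests need it. Types with literally
equal codes can then be exchanged at no cost by `Poly.of_code`. -/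
class Coded (α : Type) where
  code : α → Dat

open Coded (code)

class CodeInj (α : Type) [Coded α] : Prop where
  inj : Function.Injective (code : α → Dat)

section Codes

variable {α β : Type} [Coded α] [Coded β]

/-- The length of the code. -/
def csize (a : α) : ℕ := (code a).size

theorem csize_pos (a : α) : 0 < csize a := Dat.size_pos _

instance : Coded Dat := ⟨id⟩

instance : Coded Unit := ⟨fun _ => .nil⟩

instance : Coded Bool := ⟨Dat.ofBool⟩

instance : Coded (α × β) := ⟨fun p => .node (code p.1) (code p.2)⟩

def codeList : List α → Dat
  | [] => .nil
  | a :: l => .node (code a) (codeList l)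

instance : Coded (List α) := ⟨codeList⟩

instance : Coded (Option α) := ⟨fun o => code o.toList⟩

@[simp] theorem csize_prod (a : α) (b : β) : csize (a, b) = csize a + csize b + 1 := rfl

@[simp] theorem csize_nil : csize ([] : List α) = 1 := rfl

@[simp] theorem csize_cons (a : α) (l : List α) : csize (a :: l) = csize a + csize l + 1 := rfl

@[simp] theorem csize_none : csize (none : Option α) = 1 := rfl

@[simp] theorem csize_some (a : α) : csize (some a) = csize a + 1 + 1 := rfl

theorem csize_bool (b : Bool) : csize b ≤ 3 := by cases b <;> decide

theorem code_pair (a : α) (b : β) : code (a, b) = .node (code a) (code b) := rfl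

theorem code_nil : code ([] : List α) = .nil := rfl

theorem code_cons (a : α) (l : List α) : code (a :: l) = .node (code a) (code l) := rfl

theorem csize_append (l l' : List α) : csize (l ++ l') + 1 = csize l + csize l' := by
  induction l with
  | nil => simp; omega
  | cons a l ih => simp; omega

theorem csize_le_of_mem {a : α} {l : List α} (h : a ∈ l) : csize a ≤ csize l := by
  induction l with
  | nil => simp at h
  | cons b l ih =>
    rcases List.mem_cons.1 h with rfl | h
    · simp; omega
    · have := ih h
      simp; omega

theorem length_le_csize (l : List α) : l.length ≤ csize l := by
  induction l with
  | nil => simp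
  | cons b l ih => simp; omega

instance : CodeInj Bool := ⟨fun a b => by cases a <;> cases b <;> simp [code, Dat.ofBool]⟩

instance [CodeInj α] [CodeInj β] : CodeInj (α × β) := ⟨fun p q h => by
  simp only [code, Dat.node.injEq] at h
  exact Prod.ext (CodeInj.inj h.1) (CodeInj.inj h.2)⟩

instance [CodeInj α] : CodeInj (List α) := ⟨fun l l' h => by
  induction l generalizing l' with
  | nil => cases l' with
    | nil => rfl
    | cons b l' => cases h
  | cons a l ih => cases l' with
    | nil => cases h
    | cons b l' =>
      rw [code_cons, code_cons, Dat.node.injEq] at h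
      rw [CodeInj.inj h.1, @ih l' h.2]⟩

instance [CodeInj α] : CodeInj (Option α) := ⟨fun o o' h => by
  have h' : o.toList = o'.toList := CodeInj.inj h
  cases o <;> cases o' <;> simp_all⟩

end Codes

theorem eval_mono (p : Polynomial ℕ) {m n : ℕ} (h : m ≤ n) : p.eval m ≤ p.eval n := by
  induction p using Polynomial.induction_on' with
  | add p q hp hq => simp only [Polynomial.eval_add]; omega
  | monomial k a =>
    simp only [Polynomial.eval_monomial]
    gcongr

/-- The function `f` is computed in polynomial time by a flowchart that replaces the code of `a` on
top of the main stack by the code of `f a`. -/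
@[fun_prop]
def Poly {α β : Type} [Coded α] [Coded β] (f : α → β) : Prop :=
  ∀ (Γ₀ : Type) [Fintype Γ₀], ∃ (F : Flow (Alph Γ₀)) (p : Polynomial ℕ), ∀ a : α,
    csize (f a) ≤ p.eval (csize a) ∧
    ∀ r : List Bool, F.Run (ready Γ₀ ((code a).enc ++ r)) (p.eval (csize a))
      (ready Γ₀ ((code (f a)).enc ++ r))

/-! ### Closure of `Poly` under composition, pairing, case distinction and iteration. -/

section Closure

variable {Γ₀ : Type} [Fintype Γ₀] {α α' β γ σ : Type}
variable [Coded α] [Coded α'] [Coded β] [Coded γ] [Coded σ]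

/-- Only the codes matter. -/
theorem Poly.of_code {f : α → β} {g : α' → γ} (hg : Poly g) (u : α → α')
    (hu : ∀ a, code (u a) = code a) (hv : ∀ a, code (f a) = code (g (u a))) : Poly f := by
  intro Γ₀ _
  obtain ⟨F, p, h⟩ := hg Γ₀
  refine ⟨F, p, fun a => ?_⟩
  have := h (u a)
  simpa only [csize, hu, ← hv] using this

theorem Poly.congr {f g : α → β} (hg : Poly g) (h : ∀ a, f a = g a) : Poly f :=
  (funext h : f = g) ▸ hg

@[fun_prop]
theorem Poly.id : Poly (fun a : α => a) := fun _ _ =>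
  ⟨Flow.skip _, Polynomial.X + 1, fun a => ⟨by simp, fun r =>
    (Flow.skip_run _).mono (by simp)⟩⟩

@[fun_prop]
theorem Poly.comp {g : β → γ} {f : α → β} (hg : Poly g) (hf : Poly f) :
    Poly (fun a => g (f a)) := by
  intro Γ₀ _
  obtain ⟨F, p, hF⟩ := hf Γ₀
  obtain ⟨G, q, hG⟩ := hg Γ₀
  refine ⟨F.seq G, p + q.comp p, fun a => ?_⟩
  obtain ⟨hs, hr⟩ := hF a
  obtain ⟨hs', hr'⟩ := hG (f a)
  have hq := eval_mono q hs
  simp only [Polynomial.eval_add, Polynomial.eval_comp]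
  exact ⟨by omega, fun r => ((hr r).seq (hr' r)).mono (by omega)⟩

@[fun_prop]
theorem Poly.const (b : β) : Poly (fun _ : α => b) := by
  intro Γ₀ _
  refine ⟨(dropTop Γ₀).seq (pushBits (code b).enc), 7 * Polynomial.X + 4 + Polynomial.C (csize b),
    fun a => ⟨by simp, fun r => ?_⟩⟩
  refine ((dropTop_run _).seq (pushBits_run _)).mono ?_
  simp [csize]
  omega

-- Programs leave everything below the top tree untouched. So the argument is duplicated, each
-- function runs on its own copy, and one pushed bit `true` turns the two adjacent results into the
-- code of a pair.
@[fun_prop]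
theorem Poly.prodMk {f : α → β} {g : α → γ} (hf : Poly f) (hg : Poly g) :
    Poly (fun a => (f a, g a)) := by
  intro Γ₀ _
  obtain ⟨F, p, hF⟩ := hf Γ₀
  obtain ⟨G, q, hG⟩ := hg Γ₀
  refine ⟨(dup Γ₀).seq (F.seq ((swapTop Γ₀).seq (G.seq ((swapTop Γ₀).seq
    (Flow.push (Γ := Alph Γ₀) (some .main) true))))), 19 * Polynomial.X + 18 + 15 * p + 8 * q,
    fun a => ?_⟩
  obtain ⟨hs, hr⟩ := hF a
  obtain ⟨hs', hr'⟩ := hG a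
  simp only [csize] at *
  refine ⟨by simp [code]; simp [Dat.size]; omega, fun r => ?_⟩
  refine ((dup_run (code a) (r := r)).seq ((hr _).seq ((swapTop_run _ _).seq
    ((hr' _).seq ((swapTop_run _ _).seq (push_main_run true)))))).congr ?_ ?_
  · simp
    omega
  · simp [code, Dat.enc, ready]

theorem Poly.fst : Poly (Prod.fst : α × β → α) := by
  intro Γ₀ _
  refine ⟨Flow.branch (Γ := Alph Γ₀) (some .main) fun _ => (swapTop Γ₀).seq (dropTop Γ₀),
    14 * Polynomial.X + 10, fun ⟨a, b⟩ => ⟨by simp; omega, fun r => ?_⟩⟩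
  rw [code_pair, Dat.enc, List.cons_append, List.append_assoc]
  refine (branch_main_run ((swapTop_run _ _).seq (dropTop_run _))).mono ?_
  simp [csize, code_pair, Dat.size]
  omega

theorem Poly.snd : Poly (Prod.snd : α × β → β) := by
  intro Γ₀ _
  refine ⟨Flow.branch (Γ := Alph Γ₀) (some .main) fun _ => dropTop Γ₀,
    14 * Polynomial.X + 10, fun ⟨a, b⟩ => ⟨by simp; omega, fun r => ?_⟩⟩
  rw [code_pair, Dat.enc, List.cons_append, List.append_assoc]
  refine (branch_main_run (dropTop_run _)).mono ?_
  simp [csize, code_pair, Dat.size]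
  omega

@[fun_prop]
theorem Poly.fst' {f : α → β × γ} (hf : Poly f) : Poly (fun a => (f a).1) := Poly.fst.comp hf

@[fun_prop]
theorem Poly.snd' {f : α → β × γ} (hf : Poly f) : Poly (fun a => (f a).2) := Poly.snd.comp hf

/-- The first bit of a list code separates the empty list from a cons. In the latter case two pushed
bits and a swap rebuild the code of `(a, b, l)`. Characterising `k` by equations avoids fixing the
syntactic form of the case distinction. -/
theorem Poly.listCases {f : α → List β} {g : α → γ} {h : α × β × List β → γ} (hf : Poly f)
    (hg : Poly g) (hh : Poly h) {k : α → γ} (hnil : ∀ a, f a = [] → k a = g a)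
    (hcons : ∀ a b l, f a = b :: l → k a = h (a, b, l)) : Poly k := by
  intro Γ₀ _
  obtain ⟨F, p, hF⟩ := hf Γ₀
  obtain ⟨G, q, hG⟩ := hg Γ₀
  obtain ⟨H, w, hH⟩ := hh Γ₀
  refine ⟨(dup Γ₀).seq (F.seq (Flow.branch (Γ := Alph Γ₀) (some .main) fun
      | some true => (Flow.push (Γ := Alph Γ₀) (some .main) true).seq ((swapTop Γ₀).seq
        ((Flow.push (Γ := Alph Γ₀) (some .main) true).seq H))
      | some false => G
      | none => Flow.skip _)),
    19 * Polynomial.X + 20 + 8 * p + q + w.comp (Polynomial.X + p + 1), fun a => ?_⟩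
  obtain ⟨hs, hr⟩ := hF a
  have hw := fun u v (huv : u ≤ v) => eval_mono w huv
  cases hfa : f a with
  | nil =>
    obtain ⟨hs', hr'⟩ := hG a
    rw [hnil a hfa]
    refine ⟨by simp; omega, fun r => ?_⟩
    have h₁ := (dup_run (code a) (r := r)).seq (hr ((code a).enc ++ r))
    rw [hfa] at h₁
    refine ((dup_run (code a) (r := r)).seq ((hr _).seq ?_)).congr
      (u := _) (t := 12 * csize a + 5 + (p.eval (csize a) + (q.eval (csize a) + 1)))
      (by simp; omega) rfl
    rw [hfa]
    exact branch_main_run (hr' r)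
  | cons b l =>
    obtain ⟨hs', hr'⟩ := hH (a, b, l)
    rw [hcons a b l hfa]
    have hle := hw (csize (a, b, l)) (csize a + p.eval (csize a) + 1)
      (by rw [hfa] at hs; simp at hs ⊢; omega)
    refine ⟨by simp at hle hs' ⊢; omega, fun r => ?_⟩
    have h₃ : (Flow.push (Γ := Alph Γ₀) (some .main) true).Run
        (ready Γ₀ ((code b).enc ++ ((code l).enc ++ ((code a).enc ++ r)))) 1
        (ready Γ₀ ((code (b, l)).enc ++ ((code a).enc ++ r))) :=
      (push_main_run true).congr le_rfl (by simp [ready, code, Dat.enc])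
    have h₄ : (Flow.push (Γ := Alph Γ₀) (some .main) true).Run
        (ready Γ₀ ((code a).enc ++ ((code (b, l)).enc ++ r))) 1
        (ready Γ₀ ((code (a, b, l)).enc ++ r)) :=
      (push_main_run true).congr le_rfl (by simp [ready, code, Dat.enc])
    have h₅ := h₃.seq ((swapTop_run _ _).seq (h₄.seq (hr' r)))
    refine ((dup_run (code a) (r := r)).seq ((hr _).seq (u := 1 + (7 * (code (b, l)).size +
      7 * (code a).size + 6 + (1 + w.eval (csize (a, b, l)))) + 1) ?_)).mono ?_
    · rw [hfa, code_cons, Dat.enc, List.cons_append, List.append_assoc]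
      exact branch_main_run h₅
    · have hc : (code (b, l)).size ≤ p.eval (csize a) := by rw [hfa] at hs; exact hs
      simp only [csize, Polynomial.eval_add, Polynomial.eval_mul, Polynomial.eval_comp,
        Polynomial.eval_X, Polynomial.eval_one, Polynomial.eval_ofNat] at *
      omega

open Classical in
theorem Poly.decideEq [CodeInj α] : Poly (fun p : α × α => decide (p.1 = p.2)) := by
  intro Γ₀ _
  refine ⟨Flow.branch (Γ := Alph Γ₀) (some .main) fun _ => testEq Γ₀,
    15 * Polynomial.X + 30, fun ⟨a, b⟩ => ⟨(csize_bool _).trans (by simp), fun r => ?_⟩⟩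
  rw [code_pair, Dat.enc, List.cons_append, List.append_assoc]
  refine (branch_main_run (testEq_run _ _)).congr ?_ ?_
  · simp [csize, code_pair, Dat.size]
    omega
  · simp [CodeInj.inj.eq_iff, code]

/-- The state lies directly below the list that is being consumed; the terminating leaf is removed
on exit and leaves only the state. The bound `B` on all intermediate states is essential, since
iterating a polynomial-time step may otherwise let the state grow exponentially. -/
theorem Poly.foldlAux {L : α → List β} {s₀ : α → σ} {h : σ × β → σ} (hL : Poly L) (hs : Poly s₀)
    (hh : Poly h) (B : Polynomial ℕ)
    (hB : ∀ a l₁ l₂, L a = l₁ ++ l₂ →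
      csize (l₁.foldl (fun s b => h (s, b)) (s₀ a)) ≤ B.eval (csize a)) :
    Poly (fun a => (L a).foldl (fun s b => h (s, b)) (s₀ a)) := by
  have hstep : Poly (fun x : (β × List β) × σ => (x.1.2, h (x.2, x.1.1))) := by fun_prop
  intro Γ₀ _
  obtain ⟨W, w, hW⟩ := hstep Γ₀
  obtain ⟨P, p, hP⟩ := (hL.prodMk hs) Γ₀
  -- Two bits turn the adjacent codes of `b`, `l`, `s` into that of `((b, l), s)`. After `W`,
  -- removing the bit of the resulting pair separates the remaining list from the new state.
  let body : Flow (Alph Γ₀) := (Flow.push (Γ := Alph Γ₀) (some .main) true).seq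
    ((Flow.push (Γ := Alph Γ₀) (some .main) true).seq
      (W.seq (Flow.branch (Γ := Alph Γ₀) (some .main) fun _ => Flow.skip _)))
  let loop : Flow (Alph Γ₀) := Flow.loop (Γ := Alph Γ₀) (some .main) (fun o => o == some true)
    fun _ => body
  have hloop : ∀ (l : List β) (s : σ) (N M : ℕ) (r : List Bool),
      (∀ l₁ l₂, l = l₁ ++ l₂ → csize (l₁.foldl (fun s b => h (s, b)) s) ≤ M) → csize l ≤ N →
      loop.Run (ready Γ₀ ((code l).enc ++ ((code s).enc ++ r)))
        (l.length * (w.eval (N + M + 1) + 5) + 1)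
        (ready Γ₀ ((code (l.foldl (fun s b => h (s, b)) s)).enc ++ r)) := by
    intro l
    induction l with
    | nil =>
      intro s N M r _ _
      refine (Flow.loop_exit ?_).congr (by simp) ?_
      · simp [code_nil, Dat.enc, ready]
      · simp [code_nil, Dat.enc, ready]
    | cons b l ih =>
      intro s N M r hM hN
      have h₁ := ih (h (s, b)) N M r (fun l₁ l₂ e => hM (b :: l₁) l₂ (by simp [e]))
        (by simp at hN; omega)
      obtain ⟨hs, hr⟩ := hW ((b, l), s)
      have hsize : w.eval (csize ((b, l), s)) ≤ w.eval (N + M + 1) := by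
        refine eval_mono w ?_
        have := hM [] (b :: l) rfl
        simp at this hN ⊢
        omega
      have h₂ : body.Run (ready Γ₀ ((code b).enc ++ ((code l).enc ++ ((code s).enc ++ r))))
          (1 + (1 + (w.eval (N + M + 1) + 2)))
          (ready Γ₀ ((code l).enc ++ ((code (h (s, b))).enc ++ r))) := by
        refine (push_main_run true).seq ((push_main_run true).seq
          (Flow.Run.seq (S' := ready Γ₀ ((code (l, h (s, b))).enc ++ r)) ?_ ?_))
        · refine cast ?_ ((hr r).mono hsize)
          simp [code_pair, Dat.enc, ready]
        · rw [code_pair, Dat.enc, List.cons_append, List.append_assoc]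
          exact branch_main_run (Flow.skip_run _)
      refine (Flow.Run.loop (t := 1 + (1 + (w.eval (N + M + 1) + 2))) ?_ ?_ h₁).mono ?_
      · simp [code_cons, Dat.enc, ready]
      · refine cast ?_ h₂
        simp [code_cons, Dat.enc, ready]
      · simp only [List.length_cons]
        ring_nf
        omega
  refine ⟨P.seq (Flow.branch (Γ := Alph Γ₀) (some .main) fun _ => loop),
    p + p * (w.comp (p + B + 1) + 5) + 2 + B, fun a => ⟨?_, fun r => ?_⟩⟩
  · have := hB a (L a) [] (by simp)
    simp
    omega
  · obtain ⟨hs, hr⟩ := hP a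
    have hLs : csize (L a) ≤ p.eval (csize a) := by simp at hs; omega
    have h₁ := hloop (L a) (s₀ a) (p.eval (csize a)) (B.eval (csize a)) r (hB a) hLs
    refine ((hr r).seq (Flow.Run.mono (t := (L a).length * (w.eval (p.eval (csize a) +
      B.eval (csize a) + 1) + 5) + 1 + 1) (u := p.eval (csize a) * (w.eval (p.eval (csize a) +
      B.eval (csize a) + 1) + 5) + 1 + 1) ?_ ?_)).mono ?_
    · rw [code_pair, Dat.enc, List.cons_append, List.append_assoc]
      exact branch_main_run h₁
    · have := (length_le_csize (L a)).trans hLs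
      gcongr
    · simp
      omega

end Closure

/-! ### A library of functions computable in polynomial time -/

section Library

variable {α β γ σ : Type} [Coded α] [Coded β] [Coded γ] [Coded σ]

theorem Poly.exists_csize_le {f : α → β} (hf : Poly f) :
    ∃ p : Polynomial ℕ, ∀ a, csize (f a) ≤ p.eval (csize a) := by
  obtain ⟨F, p, h⟩ := hf Unit
  exact ⟨p, fun a => (h a).1⟩

-- A nonempty list has the same code as the pair of its head and its tail.
@[fun_prop]
theorem Poly.cons {f : α → β} {g : α → List β} (hf : Poly f) (hg : Poly g) :
    Poly (fun a => f a :: g a) :=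
  (hf.prodMk hg).of_code (fun a => a) (fun _ => rfl) fun _ => rfl

@[fun_prop]
theorem Poly.some {f : α → β} (hf : Poly f) : Poly (fun a => some (f a)) :=
  (hf.cons (Poly.const [])).of_code (fun a => a) (fun _ => rfl) fun _ => rfl

@[fun_prop]
theorem Poly.toList {f : α → Option β} (hf : Poly f) : Poly (fun a => (f a).toList) :=
  hf.of_code (fun a => a) (fun _ => rfl) fun _ => rfl

@[fun_prop]
theorem Poly.cond {c : α → Bool} {f g : α → β} (hc : Poly c) (hf : Poly f) (hg : Poly g) :
    Poly (fun a => cond (c a) (f a) (g a)) := by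
  have hc' : Poly (fun a => if c a then [()] else []) :=
    hc.of_code (fun a => a) (fun _ => rfl) fun a => by cases c a <;> rfl
  refine hc'.listCases hg (hf.comp Poly.fst) (fun a h => ?_) fun a b l h => ?_
  · cases hca : c a <;> simp_all
  · cases hca : c a <;> simp_all

@[fun_prop]
theorem Poly.and {f g : α → Bool} (hf : Poly f) (hg : Poly g) : Poly (fun a => f a && g a) :=
  (hf.cond hg (Poly.const false)).congr fun a => by cases f a <;> rfl

@[fun_prop]
theorem Poly.or {f g : α → Bool} (hf : Poly f) (hg : Poly g) : Poly (fun a => f a || g a) :=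
  (hf.cond (Poly.const true) hg).congr fun a => by cases f a <;> rfl

@[fun_prop]
theorem Poly.not {f : α → Bool} (hf : Poly f) : Poly (fun a => !f a) :=
  (hf.cond (Poly.const false) (Poly.const true)).congr fun a => by cases f a <;> rfl

open Classical in
/-- Equality as a Boolean function. -/
noncomputable def eqb {α : Type} (a b : α) : Bool := decide (a = b)

@[simp] theorem eqb_iff {α : Type} {a b : α} : eqb a b = true ↔ a = b := by simp [eqb]

@[simp] theorem eqb_false_iff {α : Type} {a b : α} : eqb a b = false ↔ a ≠ b := by simp [eqb]

@[fun_prop]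
theorem Poly.eqb [CodeInj β] {f g : α → β} (hf : Poly f) (hg : Poly g) :
    Poly (fun a => eqb (f a) (g a)) :=
  Poly.decideEq.comp (hf.prodMk hg)

theorem Poly.of_eq_some {f : α → Option β} (hf : Poly f) {g : α → β}
    (h : ∀ a, f a = Option.some (g a)) : Poly g := by
  have h' : Poly (fun a => (g a, ([] : List Unit))) :=
    hf.of_code (fun a => a) (fun _ => rfl) fun a => by rw [h]; rfl
  exact h'.fst'

theorem Poly.option_elim {f : α → Option β} {g : α → γ} {h : α → β → γ} (hf : Poly f)
    (hg : Poly g) (hh : Poly (fun p : α × β => h p.1 p.2)) :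
    Poly (fun a => (f a).elim (g a) (h a)) := by
  have hh' : Poly (fun p : α × β × List β => h p.1 p.2.1) :=
    hh.comp (f := fun p : α × β × List β => (p.1, p.2.1)) (by fun_prop)
  refine hf.toList.listCases hg hh' (fun a h => ?_) fun a b l h => ?_
  · cases hfa : f a <;> simp_all
  · cases hfa : f a <;> simp_all

@[fun_prop]
theorem Poly.getD {f : α → Option β} {g : α → β} (hf : Poly f) (hg : Poly g) :
    Poly (fun a => (f a).getD (g a)) :=
  (hf.option_elim hg Poly.snd).congr fun a => by cases f a <;> rfl

@[fun_prop]
theorem Poly.head? {f : α → List β} (hf : Poly f) : Poly (fun a => (f a).head?) :=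
  hf.listCases (g := fun _ => none) (h := fun p => Option.some p.2.1) (Poly.const _)
    (by fun_prop) (fun a h => by simp [h]) fun a b l h => by simp [h]

@[fun_prop]
theorem Poly.tail {f : α → List β} (hf : Poly f) : Poly (fun a => (f a).tail) :=
  hf.listCases (g := fun _ => []) (h := fun p => p.2.2) (Poly.const _)
    (by fun_prop) (fun a h => by simp [h]) fun a b l h => by simp [h]

/-- The step may depend on the input `a`, which is carried along as part of the state. -/
theorem Poly.foldl_of_bound {L : α → List β} {s₀ : α → σ} {h : α → σ → β → σ} (hL : Poly L)
    (hs : Poly s₀) (hh : Poly (fun p : α × σ × β => h p.1 p.2.1 p.2.2)) (B : Polynomial ℕ)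
    (hB : ∀ a l₁ l₂, L a = l₁ ++ l₂ → csize (l₁.foldl (h a) (s₀ a)) ≤ B.eval (csize a)) :
    Poly (fun a => (L a).foldl (h a) (s₀ a)) := by
  have key : ∀ (a : α) (l : List β) (s : σ),
      l.foldl (fun (s : α × σ) b => (s.1, h s.1 s.2 b)) (a, s) = (a, l.foldl (h a) s) := by
    intro a l
    induction l with
    | nil => intro s; rfl
    | cons b l ih => intro s; exact ih _
  have h' : Poly (fun x : (α × σ) × β => (x.1.1, h x.1.1 x.1.2 x.2)) :=
    (by fun_prop : Poly fun x : (α × σ) × β => x.1.1).prodMk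
      (hh.comp (f := fun x : (α × σ) × β => (x.1.1, x.1.2, x.2)) (by fun_prop))
  have := Poly.foldlAux hL (Poly.id.prodMk hs) h' (Polynomial.X + B + 1) fun a l₁ l₂ e => by
    have := hB a l₁ l₂ e
    simp [key]
    omega
  exact this.snd'.congr fun a => by simp [key]

/-- If each step enlarges the state by an amount bounded in terms of the input alone, the final size
is at most the initial size plus length times increment. -/
theorem Poly.foldl {L : α → List β} {s₀ : α → σ} {h : α → σ → β → σ} (hL : Poly L)
    (hs : Poly s₀) (hh : Poly (fun p : α × σ × β => h p.1 p.2.1 p.2.2)) (B : Polynomial ℕ)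
    (hB : ∀ a s b, b ∈ L a → csize (h a s b) ≤ csize s + B.eval (csize a)) :
    Poly (fun a => (L a).foldl (h a) (s₀ a)) := by
  obtain ⟨p, hp⟩ := hs.exists_csize_le
  obtain ⟨q, hq⟩ := hL.exists_csize_le
  refine Poly.foldl_of_bound hL hs hh (p + q * B) fun a l₁ l₂ e => ?_
  have key : ∀ l : List β, (∀ b ∈ l, b ∈ L a) → ∀ s,
      csize (l.foldl (h a) s) ≤ csize s + l.length * B.eval (csize a) := by
    intro l
    induction l with
    | nil => simp
    | cons b l ih =>
      intro hl s
      have h₁ := ih (fun b hb => hl b (by simp [hb])) (h a s b)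
      have h₂ := hB a s b (hl b (by simp))
      simp only [List.foldl_cons, List.length_cons, add_mul, one_mul]
      omega
  have h₁ := key l₁ (fun b hb => by simp [e, hb]) (s₀ a)
  have h₂ : l₁.length ≤ q.eval (csize a) := by
    have := length_le_csize (L a)
    have := hq a
    simp only [e, List.length_append] at *
    omega
  have h₃ := Nat.mul_le_mul_right (B.eval (csize a)) h₂
  have := hp a
  simp only [Polynomial.eval_add, Polynomial.eval_mul]
  omega

@[fun_prop]
theorem Poly.reverse {f : α → List β} (hf : Poly f) : Poly (fun a => (f a).reverse) := by
  obtain ⟨p, hp⟩ := hf.exists_csize_le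
  refine (Poly.foldl (h := fun _ acc b => b :: acc) hf (Poly.const []) (by fun_prop) (p + 1)
    fun a s b hb => ?_).congr fun a => ?_
  · have := hp a
    have := csize_le_of_mem hb
    simp
    omega
  · have : ∀ l acc : List β, l.foldl (fun acc b => b :: acc) acc = l.reverse ++ acc := by
      intro l
      induction l with
      | nil => simp
      | cons b l ih => simp [ih]
    simp [this]

@[fun_prop]
theorem Poly.append {f g : α → List β} (hf : Poly f) (hg : Poly g) :
    Poly (fun a => f a ++ g a) := by
  obtain ⟨p, hp⟩ := hf.exists_csize_le
  refine (Poly.foldl (h := fun _ acc b => b :: acc) hf.reverse hg (by fun_prop) (p + 1)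
    fun a s b hb => ?_).congr fun a => ?_
  · have := hp a
    have := csize_le_of_mem (List.mem_reverse.1 hb)
    simp
    omega
  · simp

theorem Poly.flatMap {f : α → List β} {g : α → β → List γ} (hf : Poly f)
    (hg : Poly (fun p : α × β => g p.1 p.2)) : Poly (fun a => (f a).flatMap (g a)) := by
  obtain ⟨p, hp⟩ := hf.exists_csize_le
  obtain ⟨q, hq⟩ := hg.exists_csize_le
  refine (Poly.foldl (h := fun a acc b => g a b ++ acc) hf.reverse (Poly.const [])
    ((hg.comp (f := fun x : α × List γ × β => (x.1, x.2.2)) (by fun_prop)).append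
      (by fun_prop)) (q.comp (Polynomial.X + p + 1))
    fun a s b hb => ?_).congr fun a => ?_
  · have h₁ := csize_append (g a b) s
    have h₂ := hq (a, b)
    have h₃ := csize_le_of_mem (List.mem_reverse.1 hb)
    have h₄ := hp a
    have h₅ := eval_mono q (m := csize (a, b)) (n := csize a + p.eval (csize a) + 1)
      (by simp; omega)
    simp at h₂ ⊢
    simp at h₅
    omega
  · rw [List.foldl_reverse]
    induction f a with
    | nil => rfl
    | cons b l ih => simp [ih]

theorem Poly.map {f : α → List β} {g : α → β → γ} (hf : Poly f)
    (hg : Poly (fun p : α × β => g p.1 p.2)) : Poly (fun a => (f a).map (g a)) :=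
  (hf.flatMap (g := fun a b => [g a b]) (hg.cons (Poly.const []))).congr fun _ =>
    List.map_eq_flatMap

theorem Poly.any {f : α → List β} {g : α → β → Bool} (hf : Poly f)
    (hg : Poly (fun p : α × β => g p.1 p.2)) : Poly (fun a => (f a).any (g a)) := by
  refine (Poly.foldl (h := fun a acc b => acc || g a b) hf (Poly.const false)
    (.or (by fun_prop) (hg.comp (f := fun x : α × Bool × β => (x.1, x.2.2)) (by fun_prop))) 3
    fun a s b hb => (csize_bool _).trans (by simp)).congr fun a => ?_
  have : ∀ (l : List β) (c : Bool), l.foldl (fun acc b => acc || g a b) c = (c || l.any (g a)) := by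
    intro l
    induction l with
    | nil => simp
    | cons b l ih => intro c; simp [ih, Bool.or_assoc]
  rw [this, Bool.false_or]

theorem Poly.all {f : α → List β} {g : α → β → Bool} (hf : Poly f)
    (hg : Poly (fun p : α × β => g p.1 p.2)) : Poly (fun a => (f a).all (g a)) :=
  (hf.any (g := fun a b => !g a b) hg.not).not.congr fun a => by simp [List.all_eq_not_any_not]

@[fun_prop]
theorem Poly.zip {f : α → List β} {g : α → List γ} (hf : Poly f) (hg : Poly g) :
    Poly (fun a => (f a).zip (g a)) := by
  obtain ⟨p, hp⟩ := hf.exists_csize_le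
  -- The state consists of the unread rest of the second list and the pairs formed so far, in
  -- reverse order.
  let h : α → List γ × List (β × γ) → β → List γ × List (β × γ) := fun _ s b =>
    (s.1.tail, s.1.head?.elim s.2 fun c => (b, c) :: s.2)
  have hh : Poly (fun p : α × (List γ × List (β × γ)) × β => h p.1 p.2.1 p.2.2) :=
    .prodMk (by fun_prop) (.option_elim (f := fun p => p.2.1.1.head?) (g := fun p => p.2.1.2)
      (h := fun (p : α × (List γ × List (β × γ)) × β) c => (p.2.2, c) :: p.2.1.2) (by fun_prop)
      (by fun_prop) (by fun_prop))
  refine (Poly.foldl hf (hg.prodMk (Poly.const [])) hh (p + 1) fun a s b hb => ?_).snd'.reverse.congr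
    fun a => ?_
  · have := hp a
    have := csize_le_of_mem hb
    obtain ⟨_ | ⟨c, l⟩, acc⟩ := s
    · simp [h]
    · simp [h]
      omega
  · have : ∀ (l : List β) (l' : List γ) (acc : List (β × γ)),
        (l.foldl (h a) (l', acc)).2 = (l.zip l').reverse ++ acc := by
      intro l
      induction l with
      | nil => simp
      | cons b l ih =>
        intro l' acc
        cases l' with
        | nil => simp [h, ih]
        | cons c l' => simp [h, ih]
    simp [this]

theorem Poly.map_fixed {ι : Type} {f : ι → α → β} (hf : ∀ i, Poly (f i)) (l : List ι) :
    Poly (fun a => l.map fun i => f i a) := by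
  induction l with
  | nil => exact Poly.const []
  | cons i l ih => exact (hf i).cons ih

@[fun_prop]
theorem Poly.getElem? {f : α → List β} (hf : Poly f) (j : ℕ) : Poly (fun a => (f a)[j]?) := by
  induction j generalizing f with
  | zero => exact hf.head?.congr fun a => List.head?_eq_getElem?.symm
  | succ j ih => exact (ih hf.tail).congr fun a => List.getElem?_tail.symm

/-- Case distinction over a finite type. -/
theorem Poly.finite_cases {ι : Type} [Finite ι] [Coded ι] [CodeInj ι] {c : α → ι} (hc : Poly c)
    {g : ι → α → β} (hg : ∀ i, Poly (g i)) : Poly (fun a => g (c a) a) := by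
  rcases isEmpty_or_nonempty α with hα | ⟨⟨a₀⟩⟩
  · exact fun _ _ => ⟨Flow.skip _, 0, fun a => hα.elim a⟩
  -- A cascade of equality tests along a list of values. Outside that list the function is
  -- irrelevant, so `g (c a₀)` serves as the default.
  have key : ∀ l : List ι, ∃ k : α → β, Poly k ∧ ∀ a, c a ∈ l → k a = g (c a) a := by
    intro l
    induction l with
    | nil => exact ⟨g (c a₀), hg _, by simp⟩
    | cons i l ih =>
      obtain ⟨k, hk, h⟩ := ih
      refine ⟨fun a => bif (StackFlow.eqb (c a) i) then (g i a) else (k a), by fun_prop, fun a ha => ?_⟩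
      by_cases hi : c a = i
      · beta_reduce
        rw [eqb_iff.2 hi, cond_true, hi]
      · beta_reduce
        rw [eqb_false_iff.2 hi, cond_false]
        exact h a (by simpa [hi] using ha)
  have := Fintype.ofFinite ι
  obtain ⟨k, hk, h⟩ := key Finset.univ.toList
  exact hk.congr fun a => (h a (by simp)).symm

/-! Numbers and tuples -/

instance : Coded ℕ := ⟨fun n => code (Computability.encodeNat n)⟩

instance : CodeInj ℕ := ⟨fun m n h => by
  have : Computability.encodeNat m = Computability.encodeNat n := CodeInj.inj h
  rw [← Computability.decode_encodeNat m, this, Computability.decode_encodeNat]⟩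

instance {n : ℕ} : Coded (Fin n) := ⟨fun i => code (i : ℕ)⟩

instance {n : ℕ} : CodeInj (Fin n) := ⟨fun _ _ h => Fin.ext (CodeInj.inj (α := ℕ) h)⟩

/-- The values of a tuple in increasing order of the attributes. -/
def tupleList {V : Type} {U : Finset ℕ} (t : U → V) : List V :=
  List.ofFn fun j => t (U.orderIsoOfFin rfl j)

instance {V : Type} [Coded V] {U : Finset ℕ} : Coded (U → V) := ⟨fun t => code (tupleList t)⟩

variable {U : Finset ℕ}

@[fun_prop]
theorem Poly.tupleList {f : α → U → β} (hf : Poly f) : Poly (fun a => tupleList (f a)) :=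
  hf.of_code (fun a => a) (fun _ => rfl) fun _ => rfl

/-- The attribute is fixed, so its position in the list of values is a constant independent of the
input. -/
theorem Poly.tuple_apply {f : α → U → β} (hf : Poly f) (A : U) : Poly (fun a => f a A) := by
  obtain ⟨j, rfl⟩ := (U.orderIsoOfFin rfl).surjective A
  exact (hf.tupleList.getElem? j).of_eq_some fun a => by simp [StackFlow.tupleList]

theorem Poly.tuple {f : α → U → β} (hf : ∀ A, Poly (fun a => f a A)) : Poly f :=
  (Poly.map_fixed (fun j => hf (U.orderIsoOfFin rfl j)) (List.finRange U.card)).of_code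
    (fun a => a) (fun _ => rfl) fun a =>
      congrArg (code : List β → Dat) (by simp [StackFlow.tupleList, List.ofFn_eq_map])

end Library

open IncompleteDB

/-! ### Satisfiability of conjunctions of possibly negated equalities -/

section Separable

variable {T : Type}

noncomputable def subst (a b x : T) : T := bif eqb x a then b else x

noncomputable def substPairs (a b : T) (l : List (T × T)) : List (T × T) :=
  l.map fun p => (subst a b p.1, subst a b p.2)

/-- Eliminate the first equality by a substitution. -/
noncomputable def elimEq (s : List (T × T) × List (T × T)) : List (T × T) × List (T × T) :=
  s.1.head?.elim s fun p => (substPairs p.1 p.2 s.1.tail, substPairs p.1 p.2 s.2)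

/-- The equalities `eqs` do not imply any of the equalities `neqs`. -/
noncomputable def separable (eqs neqs : List (T × T)) : Bool :=
  (eqs.foldl (fun s _ => elimEq s) (eqs, neqs)).2.all fun p => !eqb p.1 p.2

theorem subst_self (a b : T) : subst a b a = b := by simp [subst, eqb]

theorem subst_of_ne {a x : T} (b : T) (h : x ≠ a) : subst a b x = x := by simp [subst, eqb, h]

theorem apply_subst {V : Type} {g : T → V} {a b : T} (h : g a = g b) (x : T) :
    g (subst a b x) = g x := by
  by_cases hx : x = a
  · rw [hx, subst_self, h]
  · rw [subst_of_ne b hx]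

/-- Eliminating `x = y` preserves solvability: a solution of the substituted system becomes one of
the original by precomposition with the substitution, and a map with `g x = g y` does not notice the
substitution. Each round removes one equality, so `l` serves merely as a counter of the right
length; when no equality is left, the identity separates as much as any map can. -/
theorem separable_aux {β : Type} (l : List β) (eqs neqs : List (T × T))
    (hl : eqs.length = l.length) :
    ((l.foldl (fun s _ => elimEq s) (eqs, neqs)).2.all fun p => !eqb p.1 p.2) = true ↔
      ∃ g : T → T, (∀ p ∈ eqs, g p.1 = g p.2) ∧ ∀ p ∈ neqs, g p.1 ≠ g p.2 := by
  induction l generalizing eqs neqs with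
  | nil =>
    obtain rfl : eqs = [] := by simpa using hl
    simp only [List.foldl_nil, List.all_eq_true, Bool.not_eq_true', eqb_false_iff]
    refine ⟨fun h => ⟨id, by simp, h⟩, ?_⟩
    rintro ⟨g, -, h⟩ p hp e
    exact h p hp (congrArg g e)
  | cons b l ih =>
    obtain ⟨⟨x, y⟩, eqs, rfl⟩ : ∃ p eqs', eqs = p :: eqs' :=
      List.exists_cons_of_length_eq_add_one hl
    have e : elimEq ((x, y) :: eqs, neqs) = (substPairs x y eqs, substPairs x y neqs) := rfl
    rw [List.foldl_cons, e, ih _ _ (by simpa [substPairs] using hl)]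
    constructor
    · rintro ⟨g, h₁, h₂⟩
      refine ⟨fun t => g (subst x y t), ?_, ?_⟩
      · rintro p hp
        rcases List.mem_cons.1 hp with rfl | hp
        · simp only [subst_self]
          by_cases hyx : y = x
          · rw [hyx, subst_self]
          · rw [subst_of_ne y hyx]
        · exact h₁ _ (List.mem_map_of_mem hp)
      · exact fun p hp => h₂ _ (List.mem_map_of_mem hp)
    · rintro ⟨g, h₁, h₂⟩
      have hg : g x = g y := h₁ (x, y) (by simp)
      refine ⟨g, ?_, ?_⟩
      · intro p hp
        obtain ⟨q, hq, rfl⟩ := List.mem_map.1 hp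
        simp only [apply_subst hg]
        exact h₁ q (by simp [hq])
      · intro p hp
        obtain ⟨q, hq, rfl⟩ := List.mem_map.1 hp
        simp only [apply_subst hg]
        exact h₂ q hq

theorem separable_iff {eqs neqs : List (T × T)} : separable eqs neqs = true ↔
    ∃ g : T → T, (∀ p ∈ eqs, g p.1 = g p.2) ∧ ∀ p ∈ neqs, g p.1 ≠ g p.2 :=
  separable_aux eqs eqs neqs rfl

variable [Coded T]

theorem csize_pairs_le (l : List (T × T)) (M : ℕ)
    (h : ∀ p ∈ l, csize p.1 ≤ M ∧ csize p.2 ≤ M) : csize l ≤ l.length * (2 * M + 2) + 1 := by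
  induction l with
  | nil => simp
  | cons p l ih =>
    have h₁ := h p (by simp)
    have h₂ := ih fun q hq => h q (by simp [hq])
    obtain ⟨x, y⟩ := p
    simp [add_mul] at h₁ ⊢
    omega

theorem substPairs_bound {a b : T} {l : List (T × T)} {M : ℕ} (hb : csize b ≤ M)
    (h : ∀ p ∈ l, csize p.1 ≤ M ∧ csize p.2 ≤ M) :
    ∀ p ∈ substPairs a b l, csize p.1 ≤ M ∧ csize p.2 ≤ M := by
  have key : ∀ x, csize x ≤ M → csize (subst a b x) ≤ M := by
    intro x hx
    by_cases hxa : x = a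
    · rwa [hxa, subst_self]
    · rwa [subst_of_ne b hxa]
  intro p hp
  obtain ⟨q, hq, rfl⟩ := List.mem_map.1 hp
  exact ⟨key _ (h q hq).1, key _ (h q hq).2⟩

variable {α : Type} [Coded α] [CodeInj T]

@[fun_prop]
theorem Poly.subst {f g h : α → T} (hf : Poly f) (hg : Poly g) (hh : Poly h) :
    Poly (fun a => subst (f a) (g a) (h a)) := by
  unfold StackFlow.subst
  fun_prop

@[fun_prop]
theorem Poly.substPairs {f g : α → T} {h : α → List (T × T)} (hf : Poly f) (hg : Poly g)
    (hh : Poly h) : Poly (fun a => substPairs (f a) (g a) (h a)) :=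
  hh.map (g := fun a (p : T × T) => (StackFlow.subst (f a) (g a) p.1, StackFlow.subst (f a) (g a) p.2))
    (by fun_prop)

theorem Poly.elimEq : Poly (elimEq (T := T)) :=
  Poly.option_elim (f := fun s : List (T × T) × List (T × T) => s.1.head?)
    (h := fun s p => (StackFlow.substPairs p.1 p.2 s.1.tail, StackFlow.substPairs p.1 p.2 s.2))
    (by fun_prop) Poly.id (by fun_prop)

/-- A substitution may lengthen many entries at once, so no evident additive bound per step is
available. Instead the invariant `P` is used: the lists never get longer, and every term in them has
at most the size `M` of the input. Both lists together stay of quadratic size. -/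
theorem Poly.separable {f g : α → List (T × T)} (hf : Poly f) (hg : Poly g) :
    Poly (fun a => separable (f a) (g a)) := by
  let P : ℕ → List (T × T) × List (T × T) → Prop := fun M s =>
    s.1.length ≤ M ∧ s.2.length ≤ M ∧ (∀ p ∈ s.1, csize p.1 ≤ M ∧ csize p.2 ≤ M) ∧
      ∀ p ∈ s.2, csize p.1 ≤ M ∧ csize p.2 ≤ M
  have hstep : ∀ M s, P M s → P M (StackFlow.elimEq s) := by
    rintro M ⟨_ | ⟨⟨x, y⟩, eqs⟩, neqs⟩ ⟨h₁, h₂, h₃, h₄⟩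
    · exact ⟨h₁, h₂, h₃, h₄⟩
    · have hy : csize y ≤ M := (h₃ (x, y) (by simp)).2
      change P M (StackFlow.substPairs x y eqs, StackFlow.substPairs x y neqs)
      refine ⟨?_, ?_, substPairs_bound hy fun p hp => h₃ p (List.mem_cons_of_mem _ hp),
        substPairs_bound hy h₄⟩
      · simp [StackFlow.substPairs] at h₁ ⊢
        omega
      · simpa [StackFlow.substPairs] using h₂
  have hinit : ∀ eqs neqs : List (T × T), P (csize (eqs, neqs)) (eqs, neqs) := by
    intro eqs neqs
    have key : ∀ l : List (T × T), csize l ≤ csize (eqs, neqs) →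
        ∀ p ∈ l, csize p.1 ≤ csize (eqs, neqs) ∧ csize p.2 ≤ csize (eqs, neqs) := by
      rintro l hl ⟨x, y⟩ hp
      have := csize_le_of_mem hp
      simp only [csize_prod] at *
      omega
    have h₁ := length_le_csize eqs
    have h₂ := length_le_csize neqs
    refine ⟨?_, ?_, key _ ?_, key _ ?_⟩ <;> simp <;> omega
  have hfold : Poly (fun s : List (T × T) × List (T × T) =>
      s.1.foldl (fun s _ => StackFlow.elimEq s) s) := by
    refine Poly.foldl_of_bound (h := fun _ s _ => StackFlow.elimEq s) (by fun_prop) Poly.id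
      (Poly.elimEq.comp (by fun_prop))
      (2 * (Polynomial.X * (2 * Polynomial.X + 2) + 1) + 1) fun s l₁ l₂ _ => ?_
    have hP : ∀ (l : List (T × T)) s', P (csize s) s' →
        P (csize s) (l.foldl (fun s _ => StackFlow.elimEq s) s') := by
      intro l
      induction l with
      | nil => exact fun _ h => h
      | cons p l ih => exact fun s' h => ih _ (hstep _ _ h)
    obtain ⟨h₁, h₂, h₃, h₄⟩ := hP l₁ s (hinit s.1 s.2)
    generalize l₁.foldl (fun s _ => StackFlow.elimEq s) s = s' at *
    have h₅ := csize_pairs_le _ _ h₃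
    have h₆ := csize_pairs_le _ _ h₄
    have h₇ := Nat.mul_le_mul_right (2 * csize s + 2) h₁
    have h₈ := Nat.mul_le_mul_right (2 * csize s + 2) h₂
    obtain ⟨e, n⟩ := s'
    simp only [csize_prod, Polynomial.eval_add, Polynomial.eval_mul, Polynomial.eval_X,
      Polynomial.eval_one, Polynomial.eval_ofNat] at *
    omega
  exact ((hfold.comp (hf.prodMk hg)).snd').all (g := fun _ (p : T × T) => !StackFlow.eqb p.1 p.2)
    (by fun_prop)

end Separable

/-! ### Satisfiability over an infinite domain with constants. -/

section Sat

variable {D X : Type}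

def isConst : Term D X → Bool
  | .const _ => true
  | .var _ => false

def pairTerms {T : Type} (l : List (T × T)) : List T := l.flatMap fun p => [p.1, p.2]

/-- These inequalities hold under every valuation. Once they are listed explicitly, constants can be
treated as uninterpreted symbols. -/
noncomputable def distinctConsts (l : List (Term D X)) : List (Term D X × Term D X) :=
  l.flatMap fun a => l.flatMap fun b =>
    bif isConst a && (isConst b && !eqb a b) then [(a, b)] else []

/-- Some valuation satisfies all the equalities `eqs` and none of the equalities `neqs`. -/
noncomputable def sat (eqs neqs : List (Term D X × Term D X)) : Bool :=
  separable eqs (neqs ++ distinctConsts (pairTerms (eqs ++ neqs)))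

theorem mem_distinctConsts {l : List (Term D X)} {p : Term D X × Term D X} :
    p ∈ distinctConsts l ↔ p.1 ∈ l ∧ p.2 ∈ l ∧ isConst p.1 = true ∧ isConst p.2 = true ∧
      p.1 ≠ p.2 := by
  obtain ⟨x, y⟩ := p
  simp only [distinctConsts, List.mem_flatMap]
  constructor
  · rintro ⟨a, ha, b, hb, h⟩
    cases hc : isConst a && (isConst b && !eqb a b)
    · simp [hc] at h
    · rw [hc, cond_true, List.mem_singleton, Prod.mk.injEq] at h
      obtain ⟨rfl, rfl⟩ := h
      exact ⟨ha, hb, by simpa using hc⟩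
  · rintro ⟨hx, hy, h⟩
    refine ⟨x, hx, y, hy, ?_⟩
    rw [show (isConst x && (isConst y && !eqb x y)) = true by simpa using h]
    simp

/-- A separating map `g` partitions the occurring terms into classes, each with at most one constant
thanks to `distinctConsts`. A class with a constant takes it as its value; the other classes take
distinct values that do not occur, which exist because `D` is infinite. -/
theorem sat_iff [Infinite D] {eqs neqs : List (Term D X × Term D X)} :
    sat eqs neqs = true ↔ ∃ ν : X → D, (∀ p ∈ eqs, p.1.eval ν = p.2.eval ν) ∧
      ∀ p ∈ neqs, p.1.eval ν ≠ p.2.eval ν := by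
  rw [sat, separable_iff]
  constructor
  · rintro ⟨g, h₁, h₂⟩
    set P := pairTerms (eqs ++ neqs) with hP
    have hfin : {c : D | Term.const c ∈ P}.Finite :=
      (List.finite_toSet P).preimage (fun _ _ _ _ h => Term.const.inj h)
    have hsep : ∀ c c', Term.const c ∈ P → Term.const c' ∈ P →
        g (.const c) = g (.const c') → c = c' := by
      intro c c' hc hc' h
      by_contra hne
      exact h₂ (.const c, .const c') (List.mem_append_right _ (mem_distinctConsts.2
        ⟨hc, hc', rfl, rfl, by simpa using hne⟩)) h
    -- `e` injects the finitely many classes into the complement of the finite set of occurring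
    -- constants.
    obtain ⟨e, he, hinj⟩ := Set.Finite.exists_injOn_of_encard_le
      (s := g '' {t | t ∈ P}) (t := {c : D | Term.const c ∈ P}ᶜ)
      ((List.finite_toSet P).image g) (by rw [hfin.infinite_compl.encard_eq]; exact le_top)
    classical
    let h : Term D X → D := fun y =>
      if hy : ∃ c, Term.const c ∈ P ∧ g (.const c) = y then hy.choose else e y
    have hconst : ∀ c, Term.const c ∈ P → h (g (.const c)) = c := by
      intro c hc
      have hy : ∃ c', Term.const c' ∈ P ∧ g (.const c') = g (.const c) := ⟨c, hc, rfl⟩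
      simp only [h, dif_pos hy]
      exact hsep _ _ hy.choose_spec.1 hc hy.choose_spec.2
    have hh : ∀ a ∈ P, ∀ b ∈ P, h (g a) = h (g b) → g a = g b := by
      intro a ha b hb hab
      by_cases hya : ∃ c, Term.const c ∈ P ∧ g (.const c) = g a <;>
        by_cases hyb : ∃ c, Term.const c ∈ P ∧ g (.const c) = g b
      · obtain ⟨c, hc, hca⟩ := hya
        obtain ⟨c', hc', hcb⟩ := hyb
        rw [← hca, ← hcb, hconst c hc, hconst c' hc'] at hab
        rw [← hca, ← hcb, hab]
      · obtain ⟨c, hc, hca⟩ := hya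
        rw [← hca, hconst c hc] at hab
        simp only [h, dif_neg hyb] at hab
        exact absurd (hab ▸ hc) (he ⟨b, hb, rfl⟩)
      · obtain ⟨c, hc, hcb⟩ := hyb
        rw [← hcb, hconst c hc] at hab
        simp only [h, dif_neg hya] at hab
        exact absurd (hab ▸ hc) (he ⟨a, ha, rfl⟩)
      · simp only [h, dif_neg hya, dif_neg hyb] at hab
        exact hinj ⟨a, ha, rfl⟩ ⟨b, hb, rfl⟩ hab
    have heval : ∀ a ∈ P, a.eval (fun x => h (g (.var x))) = h (g a) := by
      rintro (c | x) ha
      · exact (hconst c ha).symm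
      · rfl
    have hmem : ∀ p ∈ eqs ++ neqs, p.1 ∈ P ∧ p.2 ∈ P := fun p hp =>
      ⟨List.mem_flatMap.2 ⟨p, hp, by simp⟩, List.mem_flatMap.2 ⟨p, hp, by simp⟩⟩
    refine ⟨fun x => h (g (.var x)), fun p hp => ?_, fun p hp => ?_⟩
    · obtain ⟨ha, hb⟩ := hmem p (List.mem_append_left _ hp)
      rw [heval _ ha, heval _ hb, h₁ p hp]
    · obtain ⟨ha, hb⟩ := hmem p (List.mem_append_right _ hp)
      rw [heval _ ha, heval _ hb]
      exact fun hab => h₂ p (List.mem_append_left _ hp) (hh _ ha _ hb hab)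
  · rintro ⟨ν, h₁, h₂⟩
    -- A valuation becomes a map on terms by sending each term to its value, regarded as a constant.
    refine ⟨fun t => .const (t.eval ν), fun p hp => by simp [h₁ p hp], fun p hp => ?_⟩
    rcases List.mem_append.1 hp with hp | hp
    · simpa using h₂ p hp
    · obtain ⟨-, -, ha, hb, hne⟩ := mem_distinctConsts.1 hp
      obtain ⟨a | _, b | _⟩ := p <;> simp_all [isConst, Term.eval]

variable [Coded D] [Coded X]

instance : Coded (Term D X) :=
  ⟨fun
    | .const c => code (true, c)
    | .var x => code (false, x)⟩

instance [CodeInj D] [CodeInj X] : CodeInj (Term D X) := ⟨by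
  rintro (a | a) (b | b) h
  · exact congrArg _ (Prod.ext_iff.1 (CodeInj.inj (α := Bool × D) h)).2
  · have h' : code (true, code a) = code (false, code b) := h
    cases h'
  · have h' : code (false, code a) = code (true, code b) := h
    cases h'
  · exact congrArg _ (Prod.ext_iff.1 (CodeInj.inj (α := Bool × X) h)).2⟩

variable {α : Type} [Coded α]

@[fun_prop]
theorem Poly.isConst {f : α → Term D X} (hf : Poly f) : Poly (fun a => isConst (f a)) := by
  -- The payload is kept as a bare tree, because its type depends on the kind of term.
  have h : Poly (fun a => (StackFlow.isConst (f a), match f a with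
      | .const c => code c
      | .var x => code x)) :=
    hf.of_code (fun a => a) (fun _ => rfl) fun a => by cases f a <;> rfl
  exact h.fst'

variable [CodeInj D] [CodeInj X]

@[fun_prop]
theorem Poly.sat {f g : α → List (Term D X × Term D X)} (hf : Poly f) (hg : Poly g) :
    Poly (fun a => sat (f a) (g a)) := by
  have h₁ : Poly (pairTerms (T := Term D X)) :=
    Poly.id.flatMap (g := fun _ (p : Term D X × Term D X) => [p.1, p.2]) (by fun_prop)
  have h₂ : Poly (distinctConsts (D := D) (X := X)) := by
    refine Poly.id.flatMap (g := fun (l : List (Term D X)) (a : Term D X) => l.flatMap fun b =>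
      bif StackFlow.isConst a && (StackFlow.isConst b && !StackFlow.eqb a b) then [(a, b)] else []) ?_
    exact Poly.fst.flatMap (g := fun (q : List (Term D X) × Term D X) (b : Term D X) =>
      bif StackFlow.isConst q.2 && (StackFlow.isConst b && !StackFlow.eqb q.2 b) then [(q.2, b)] else [])
      (by fun_prop)
  exact hf.separable (hg.append (h₂.comp (h₁.comp (hf.append hg))))

end Sat

/-! ### Evaluation of positive queries on world-set decompositions -/

section Algorithm

variable {S : RelSchema} {D X : Type}

/-- The column names and the rows of a component. -/
abbrev RawComp (S : RelSchema) (D X : Type) : Type := List (Field S) × List (List (Cell D X))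

/-- A symbolic answer: a tuple of terms, entries required in the chosen rows, and equalities
required of the valuation. -/
abbrev Sol (S : RelSchema) (D X : Type) (U : Finset ℕ) : Type :=
  (U → Term D X) × List (Field S × Term D X) × List (Term D X × Term D X)

/-- The terms in the field `f` of the row `r` of the component `C`. -/
noncomputable def fieldTerms (C : RawComp S D X) (r : List (Cell D X)) (f : Field S) :
    List (Term D X) :=
  (C.1.zip r).flatMap fun z => bif eqb z.1 f then z.2.toList else []

/-- The symbolic tuples of `R_i` with the identifier of the field `f`. -/
noncomputable def tupleSol (x₀ : Term D X) (i : Fin S.numRels) (C : RawComp S D X)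
    (r : List (Cell D X)) (f : Field S) : Sol S D X (S.attrs i) :=
  (fun A => (fieldTerms C r ⟨i, f.tid, A⟩).head?.getD x₀,
    (S.attrs i).attach.toList.map fun A =>
      (⟨i, f.tid, A⟩, (fieldTerms C r ⟨i, f.tid, A⟩).head?.getD x₀), [])

/-- The field `f` contributes only its tuple identifier, so a tuple is listed once per attribute. An
entry `⊥` is replaced by the default `x₀`; this is sound because the recorded requirement must still
be met by the row finally chosen. -/
noncomputable def relSols (x₀ : Term D X) (i : Fin S.numRels) (cs : List (RawComp S D X)) :
    List (Sol S D X (S.attrs i)) :=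
  cs.flatMap fun C => C.2.flatMap fun r => C.1.flatMap fun f =>
    bif eqb f.rel i then [tupleSol x₀ i C r f] else []

/-- A disjunctive normal form of a selection condition. -/
def condAlts {U : Finset ℕ} : SelCond D U → (U → Term D X) → List (List (Term D X × Term D X))
  | .top, _ => [[]]
  | .eqAttr A B, τ => [[(τ A, τ B)]]
  | .eqConst A c, τ => [[(τ A, .const c)]]
  | .and p q, τ => (condAlts p τ).flatMap fun e => (condAlts q τ).map fun e' => e ++ e'
  | .or p q, τ => condAlts p τ ++ condAlts q τ

def unionTuple {V : Type} {U U' : Finset ℕ} (s : U → V) (t : U' → V) (a : (U ∪ U' : Finset ℕ)) : V :=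
  if h : a.1 ∈ U then s ⟨a.1, h⟩ else t ⟨a.1, (Finset.mem_union.1 a.2).resolve_left h⟩

/-- Products multiply the numbers of symbolic answers, so the degree of the polynomial bound depends
on the query; this is where `q` has to be fixed. -/
noncomputable def sols (x₀ : Term D X) : {U : Finset ℕ} → PosQuery S D U →
    List (RawComp S D X) → List (Sol S D X U)
  | _, .rel i, cs => relSols x₀ i cs
  | _, .select p q, cs => (sols x₀ q cs).flatMap fun s =>
      (condAlts p s.1).map fun e => (s.1, s.2.1, e ++ s.2.2)
  | _, .project _ h q, cs => (sols x₀ q cs).map fun s => (fun a => s.1 ⟨a.1, h a.2⟩, s.2)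
  | _, .product _ q r, cs => (sols x₀ q cs).flatMap fun s => (sols x₀ r cs).map fun s' =>
      (unionTuple s.1 s'.1, s.2.1 ++ s'.2.1, s.2.2 ++ s'.2.2)
  | _, .union q r, cs => sols x₀ q cs ++ sols x₀ r cs
  | _, .rename f q, cs => (sols x₀ q cs).map fun s => (fun b => s.1 (f.symm b), s.2)

/-- Every component has a row with the required entries. -/
noncomputable def compat (cs : List (RawComp S D X)) (asg : List (Field S × Term D X)) : Bool :=
  cs.all fun C => C.2.any fun r => (C.1.zip r).all fun z => asg.all fun p =>
    !eqb p.1 z.1 || eqb (some p.2) z.2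

/-- The fields of the required entries exist. -/
noncomputable def covered (cs : List (RawComp S D X)) (asg : List (Field S × Term D X)) : Bool :=
  asg.all fun p => cs.any fun C => C.1.any fun f => eqb f p.1

/-- Literals with a flag that distinguishes equalities from negated equalities. -/
abbrev RawLit (D X : Type) : Type := Bool × Term D X × Term D X

def litsWith (b : Bool) (ls : List (RawLit D X)) : List (Term D X × Term D X) :=
  ls.flatMap fun l => bif b then bif l.1 then [l.2] else [] else bif l.1 then [] else [l.2]

/-- The decision procedure for tuple q-possibility. -/
noncomputable def decideRaw (x₀ : Term D X) {U : Finset ℕ} (q : PosQuery S D U)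
    (x : List (RawComp S D X) × List (RawLit D X) × List (Term D X)) : Bool :=
  (sols x₀ q x.1).any fun s => (covered x.1 s.2.1 && compat x.1 s.2.1) &&
    sat (litsWith true x.2.1 ++ s.2.2 ++ (tupleList s.1).zip x.2.2) (litsWith false x.2.1)

end Algorithm

/-! ### Polynomial running time of the evaluation. -/

section PolyTime

variable {S : RelSchema} {D X : Type} [Coded D] [Coded X]

instance : Coded (Field S) := ⟨fun f => code (f.rel, f.tid, (f.attr : ℕ))⟩

instance : CodeInj (Field S) := ⟨by
  rintro ⟨i, d, a⟩ ⟨i', d', a'⟩ h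
  have h' : (i, d, (a : ℕ)) = (i', d', (a' : ℕ)) := CodeInj.inj h
  simp only [Prod.mk.injEq] at h'
  obtain ⟨rfl, rfl, h'⟩ := h'
  rw [Subtype.ext h']⟩

variable {α : Type} [Coded α]

@[fun_prop]
theorem Poly.fieldRel {f : α → Field S} (hf : Poly f) : Poly (fun a => (f a).rel) :=
  (hf.of_code (f := fun a => ((f a).rel, (f a).tid, ((f a).attr : ℕ))) (fun a => a)
    (fun _ => rfl) fun _ => rfl).fst'

@[fun_prop]
theorem Poly.fieldTid {f : α → Field S} (hf : Poly f) : Poly (fun a => (f a).tid) :=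
  (hf.of_code (f := fun a => ((f a).rel, (f a).tid, ((f a).attr : ℕ))) (fun a => a)
    (fun _ => rfl) fun _ => rfl).snd'.fst'

@[fun_prop]
theorem Poly.fieldMk {f : α → ℕ} (hf : Poly f) (i : Fin S.numRels) (A : S.attrs i) :
    Poly (fun a => (⟨i, f a, A⟩ : Field S)) :=
  ((Poly.const i).prodMk (hf.prodMk (Poly.const (A : ℕ)))).of_code (fun a => a)
    (fun _ => rfl) fun _ => rfl

@[fun_prop]
theorem Poly.fieldTerms {f : α → RawComp S D X} {g : α → List (Cell D X)} {h : α → Field S}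
    (hf : Poly f) (hg : Poly g) (hh : Poly h) :
    Poly (fun a => fieldTerms (f a) (g a) (h a)) :=
  (hf.fst'.zip hg).flatMap (g := fun a (z : Field S × Cell D X) =>
    bif StackFlow.eqb z.1 (h a) then z.2.toList else []) (by fun_prop)

theorem Poly.tupleSol (x₀ : Term D X) (i : Fin S.numRels) :
    Poly (fun x : RawComp S D X × List (Cell D X) × Field S => tupleSol x₀ i x.1 x.2.1 x.2.2) :=
  .prodMk (Poly.tuple fun A => by fun_prop) (.prodMk (Poly.map_fixed (fun A => by fun_prop) _)
    (by fun_prop))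

/-- Each `refine` peels off one of the three nested loops; the enclosing loop variables are carried
as nested pairs. -/
theorem Poly.relSols (x₀ : Term D X) (i : Fin S.numRels) :
    Poly (relSols x₀ i : List (RawComp S D X) → _) := by
  refine Poly.id.flatMap (g := fun _ (C : RawComp S D X) => C.2.flatMap fun r => C.1.flatMap fun f =>
    bif StackFlow.eqb f.rel i then [StackFlow.tupleSol x₀ i C r f] else []) ?_
  refine Poly.flatMap (f := fun p : List (RawComp S D X) × RawComp S D X => p.2.2)
    (g := fun p (r : List (Cell D X)) => p.2.1.flatMap fun f =>
    bif StackFlow.eqb f.rel i then [StackFlow.tupleSol x₀ i p.2 r f] else []) (by fun_prop) ?_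
  refine Poly.flatMap (f := fun p : (List (RawComp S D X) × RawComp S D X) × List (Cell D X) =>
    p.1.2.1) (g := fun p (f : Field S) =>
    bif StackFlow.eqb f.rel i then [StackFlow.tupleSol x₀ i p.1.2 p.2 f] else []) (by fun_prop) ?_
  exact .cond (by fun_prop) (.cons ((Poly.tupleSol x₀ i).comp
    (f := fun p : ((List (RawComp S D X) × RawComp S D X) × List (Cell D X)) × Field S =>
      (p.1.1.2, p.1.2, p.2)) (by fun_prop)) (Poly.const _)) (by fun_prop)

theorem Poly.condAlts {U : Finset ℕ} (p : SelCond D U) :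
    Poly (condAlts p : (U → Term D X) → _) := by
  induction p with
  | top => exact Poly.const _
  | eqAttr A B =>
    exact (((Poly.id.tuple_apply A).prodMk (Poly.id.tuple_apply B)).cons (Poly.const _)).cons
      (Poly.const _)
  | eqConst A c =>
    exact (((Poly.id.tuple_apply A).prodMk (Poly.const _)).cons (Poly.const _)).cons
      (Poly.const _)
  | and p q ihp ihq =>
    exact ihp.flatMap (g := fun τ e => (StackFlow.condAlts q τ).map fun e' => e ++ e')
      ((ihq.comp Poly.fst).map
        (g := fun (x : (U → Term D X) × List (Term D X × Term D X)) e' => x.2 ++ e')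
        (by fun_prop))
  | or p q ihp ihq => exact ihp.append ihq

/-- The recursion over the query takes place outside the machine: each constructor contributes a
fixed number of list operations to the program. -/
theorem Poly.sols (x₀ : Term D X) {U : Finset ℕ} (q : PosQuery S D U) :
    Poly (sols x₀ q : List (RawComp S D X) → _) := by
  induction q with
  | rel i => exact Poly.relSols x₀ i
  | @select U p q ih =>
    refine ih.flatMap (g := fun _ (s : Sol S D X U) =>
      (StackFlow.condAlts p s.1).map fun e => (s.1, s.2.1, e ++ s.2.2)) ?_
    exact ((Poly.condAlts p).comp
      (f := fun x : List (RawComp S D X) × Sol S D X U => x.2.1) (by fun_prop)).map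
      (g := fun x e => (x.2.1, x.2.2.1, e ++ x.2.2.2)) (by fun_prop)
  | @project U V h q ih =>
    refine ih.map (g := fun _ (s : Sol S D X U) => (fun a : V => s.1 ⟨a.1, h a.2⟩, s.2)) (.prodMk ?_ (by fun_prop))
    exact Poly.tuple fun A => Poly.tuple_apply
      (f := fun x : List (RawComp S D X) × Sol S D X U => x.2.1) (by fun_prop) _
  | @product U V h q r ihq ihr =>
    refine ihq.flatMap (g := fun cs (s : Sol S D X U) => (StackFlow.sols x₀ r cs).map fun (s' : Sol S D X V) =>
      (unionTuple s.1 s'.1, s.2.1 ++ s'.2.1, s.2.2 ++ s'.2.2)) ?_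
    refine (ihr.comp Poly.fst).map
      (g := fun (x : List (RawComp S D X) × Sol S D X U) (s' : Sol S D X V) =>
        (unionTuple x.2.1 s'.1, x.2.2.1 ++ s'.2.1, x.2.2.2 ++ s'.2.2)) (.prodMk ?_ (by fun_prop))
    refine Poly.tuple fun A => ?_
    by_cases hA : A.1 ∈ U
    · simp only [unionTuple, hA, dite_true]
      exact Poly.tuple_apply
        (f := fun x : (List (RawComp S D X) × Sol S D X U) × Sol S D X V => x.1.2.1)
        (by fun_prop) _
    · simp only [unionTuple, hA, dite_false]
      exact Poly.tuple_apply
        (f := fun x : (List (RawComp S D X) × Sol S D X U) × Sol S D X V => x.2.1)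
        (by fun_prop) _
  | union q r ihq ihr => exact ihq.append ihr
  | @rename U V f q ih =>
    refine ih.map (g := fun _ (s : Sol S D X U) => (fun b : V => s.1 (f.symm b), s.2)) (.prodMk ?_ (by fun_prop))
    exact Poly.tuple fun A => Poly.tuple_apply
      (f := fun x : List (RawComp S D X) × Sol S D X U => x.2.1) (by fun_prop) _

@[fun_prop]
theorem Poly.litsWith (b : Bool) {f : α → List (RawLit D X)} (hf : Poly f) :
    Poly (fun a => litsWith b (f a)) :=
  hf.flatMap (g := fun _ (l : RawLit D X) =>
    bif b then bif l.1 then [l.2] else [] else bif l.1 then [] else [l.2]) (by fun_prop)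

@[fun_prop]
theorem Poly.covered {f : α → List (RawComp S D X)} {g : α → List (Field S × Term D X)}
    (hf : Poly f) (hg : Poly g) : Poly (fun a => covered (f a) (g a)) := by
  refine hg.all (g := fun a p => (f a).any fun C => C.1.any fun g => StackFlow.eqb g p.1) ?_
  refine (hf.comp Poly.fst).any (g := fun (x : α × Field S × Term D X) (C : RawComp S D X) =>
    C.1.any fun g => StackFlow.eqb g x.2.1) ?_
  exact Poly.any (f := fun y : (α × Field S × Term D X) × RawComp S D X => y.2.1)
    (g := fun y g => StackFlow.eqb g y.1.2.1) (by fun_prop) (by fun_prop)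

variable [CodeInj D] [CodeInj X]

@[fun_prop]
theorem Poly.compat {f : α → List (RawComp S D X)} {g : α → List (Field S × Term D X)}
    (hf : Poly f) (hg : Poly g) : Poly (fun a => compat (f a) (g a)) := by
  refine hf.all (g := fun a C => C.2.any fun r => (C.1.zip r).all fun z => (g a).all fun p =>
    !StackFlow.eqb p.1 z.1 || StackFlow.eqb (Option.some p.2) z.2) ?_
  refine Poly.any (f := fun x : α × RawComp S D X => x.2.2)
    (g := fun x r => (x.2.1.zip r).all fun z => (g x.1).all fun p =>
    !StackFlow.eqb p.1 z.1 || StackFlow.eqb (Option.some p.2) z.2) (by fun_prop) ?_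
  refine Poly.all (f := fun x : (α × RawComp S D X) × List (Cell D X) => x.1.2.1.zip x.2)
    (g := fun x z => (g x.1.1).all fun p =>
    !StackFlow.eqb p.1 z.1 || StackFlow.eqb (Option.some p.2) z.2) (by fun_prop) ?_
  refine Poly.all (f := fun x : ((α × RawComp S D X) × List (Cell D X)) × Field S × Cell D X =>
    g x.1.1.1) (g := fun x (p : Field S × Term D X) =>
    !StackFlow.eqb p.1 x.2.1 || StackFlow.eqb (Option.some p.2) x.2.2)
    (hg.comp (by fun_prop)) (by fun_prop)

theorem Poly.decideRaw (x₀ : Term D X) {U : Finset ℕ} (q : PosQuery S D U) :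
    Poly (decideRaw x₀ q : List (RawComp S D X) × List (RawLit D X) × List (Term D X) → Bool) := by
  refine ((Poly.sols x₀ q).comp Poly.fst).any (g := fun (x : List (RawComp S D X) × List (RawLit D X) × List (Term D X))
      (s : Sol S D X U) =>
    (StackFlow.covered x.1 s.2.1 && StackFlow.compat x.1 s.2.1) &&
    StackFlow.sat (StackFlow.litsWith true x.2.1 ++ s.2.2 ++
      (StackFlow.tupleList s.1).zip x.2.2) (StackFlow.litsWith false x.2.1)) ?_
  fun_prop

end PolyTime

/-! ### Correctness of the evaluation -/

section Correctness

variable {S : RelSchema} {D X : Type}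

/-- The database given by the entries `ω` of all fields and a valuation. -/
def worldDB (ω : Field S → Cell D X) (ν : X → D) : Database S D := fun i =>
  {t | ∃ d, ∃ s : Tuple (Term D X) (S.attrs i),
    (∀ a, ω ⟨i, d, a⟩ = some (s a)) ∧ t = fun a => (s a).eval ν}

/-- The entries `ω` choose one row of every component. -/
def Picks (W : GWSD S D X) (ω : Field S → Cell D X) : Prop :=
  (∀ C ∈ W.comps, ∃ r ∈ C.rows, ∀ j, ω (C.field j) = r j) ∧
    ∀ f, ω f ≠ none → ∃ C ∈ W.comps, f ∈ C.schema

/-- Replaces the dependent choice of entries on the schema by a total function `ω`. It is `⊥`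
outside the schema, so an identifier with a missing field yields no tuple. -/
theorem exists_mem_rep_iff (W : GWSD S D X) (P : Database S D → Prop) :
    (∃ A ∈ W.rep, P A) ↔
      ∃ ω ν, Picks W ω ∧ (∀ l ∈ W.cond, l.Holds ν) ∧ P (worldDB ω ν) := by
  have key : ∀ (w : W.toGTST.schema → Cell D X) (ω : Field S → Cell D X) (ν : X → D),
      (∀ f (h : f ∈ W.toGTST.schema), ω f = w ⟨f, h⟩) →
      (∀ f, ω f ≠ none → ∃ C ∈ W.comps, f ∈ C.schema) →
      (GMultitable.mk (inlineInv w) W.cond).apply ν = worldDB ω ν := by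
    intro w ω ν h₁ h₂
    funext i
    ext t
    constructor
    · rintro ⟨s, ⟨d, h, hs⟩, rfl⟩
      exact ⟨d, s, fun a => (h₁ _ (h a)).trans (hs a), rfl⟩
    · rintro ⟨d, s, hs, rfl⟩
      have h : ∀ a : S.attrs i, (⟨i, d, a⟩ : Field S) ∈ W.toGTST.schema := fun a =>
        h₂ _ (by rw [hs a]; simp)
      exact ⟨s, ⟨d, h, fun a => (h₁ _ (h a)).symm.trans (hs a)⟩, rfl⟩
  constructor
  · rintro ⟨A, hA, hP⟩
    obtain ⟨w, hw, ν, hν, rfl⟩ := Set.mem_iUnion₂.1 hA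
    classical
    have h₁ : ∀ f (h : f ∈ W.toGTST.schema),
        (if h : f ∈ W.toGTST.schema then w ⟨f, h⟩ else none) = w ⟨f, h⟩ :=
      fun f h => dif_pos h
    have h₂ : ∀ f, (if h : f ∈ W.toGTST.schema then w ⟨f, h⟩ else none) ≠ none →
        ∃ C ∈ W.comps, f ∈ C.schema := by
      intro f hf
      by_contra h
      exact hf (dif_neg h)
    refine ⟨_, ν, ⟨fun C hC => ?_, h₂⟩, hν, key w _ ν h₁ h₂ ▸ hP⟩
    obtain ⟨r, hr, h⟩ := hw C hC
    exact ⟨r, hr, fun j => (h₁ _ _).trans (h j)⟩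
  · rintro ⟨ω, ν, ⟨h₁, h₂⟩, hν, hP⟩
    refine ⟨_, Set.mem_iUnion₂.2 ⟨fun f => ω f, h₁, ν, hν, rfl⟩, ?_⟩
    have := key (fun f => ω f) ω ν (fun _ _ => rfl) h₂
    rw [← this] at hP
    exact hP

/-- The tuple `t` is an instance of the symbolic answer `s`. -/
def Realizes {U : Finset ℕ} (ω : Field S → Cell D X) (ν : X → D) (s : Sol S D X U)
    (t : Tuple D U) : Prop :=
  (∀ p ∈ s.2.1, ω p.1 = some p.2) ∧ (∀ p ∈ s.2.2, p.1.eval ν = p.2.eval ν) ∧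
    t = fun A => (s.1 A).eval ν

theorem exists_condAlts_iff {U : Finset ℕ} (p : SelCond D U) (τ : U → Term D X) (ν : X → D) :
    (∃ e ∈ condAlts p τ, ∀ x ∈ e, x.1.eval ν = x.2.eval ν) ↔ p.Holds fun A => (τ A).eval ν := by
  induction p with
  | top => simp [condAlts, SelCond.Holds]
  | eqAttr A B => simp [condAlts, SelCond.Holds]
  | eqConst A c => simp [condAlts, SelCond.Holds, Term.eval]
  | and p q ihp ihq =>
    rw [SelCond.Holds, ← ihp, ← ihq]
    simp only [condAlts, List.mem_flatMap, List.mem_map]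
    constructor
    · rintro ⟨_, ⟨e, he, e', he', rfl⟩, h⟩
      exact ⟨⟨e, he, fun x hx => h x (List.mem_append_left _ hx)⟩,
        ⟨e', he', fun x hx => h x (List.mem_append_right _ hx)⟩⟩
    · rintro ⟨⟨e, he, h⟩, e', he', h'⟩
      exact ⟨_, ⟨e, he, e', he', rfl⟩, fun x hx => (List.mem_append.1 hx).elim (h x) (h' x)⟩
  | or p q ihp ihq =>
    rw [SelCond.Holds, ← ihp, ← ihq]
    simp only [condAlts, List.mem_append, or_and_right, exists_or]

/-- In a fixed world every positive operator commutes with the existential quantifier over symbolic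
answers, so only the base relations need to be assumed correct. -/
theorem mem_eval_iff {A : Database S D} {x₀ : Term D X} {cs : List (RawComp S D X)}
    {ω : Field S → Cell D X} {ν : X → D}
    (h : ∀ i t, t ∈ A i ↔ ∃ s ∈ relSols x₀ i cs, Realizes ω ν s t) {U : Finset ℕ}
    (q : PosQuery S D U) (t : Tuple D U) :
    t ∈ q.eval A ↔ ∃ s ∈ sols x₀ q cs, Realizes ω ν s t := by
  induction q with
  | rel i => exact h i t
  | select p q ih =>
    simp only [PosQuery.eval, Set.mem_ofPred_eq, sols, List.mem_flatMap, List.mem_map]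
    constructor
    · rintro ⟨ht, hp⟩
      obtain ⟨s, hs, h₁, h₂, rfl⟩ := (ih t).1 ht
      obtain ⟨e, he, h₃⟩ := (exists_condAlts_iff p s.1 ν).2 hp
      exact ⟨_, ⟨s, hs, e, he, rfl⟩, h₁, fun x hx => (List.mem_append.1 hx).elim (h₃ x) (h₂ x), rfl⟩
    · rintro ⟨_, ⟨s, hs, e, he, rfl⟩, h₁, h₂, rfl⟩
      exact ⟨(ih _).2 ⟨s, hs, h₁, fun x hx => h₂ x (List.mem_append_right _ hx), rfl⟩,
        (exists_condAlts_iff p s.1 ν).1 ⟨e, he, fun x hx => h₂ x (List.mem_append_left _ hx)⟩⟩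
  | project V hV q ih =>
    simp only [PosQuery.eval, Set.mem_ofPred_eq, sols, List.mem_map]
    constructor
    · rintro ⟨s', hs', ht⟩
      obtain ⟨s, hs, h₁, h₂, rfl⟩ := (ih s').1 hs'
      exact ⟨_, ⟨s, hs, rfl⟩, h₁, h₂, funext ht⟩
    · rintro ⟨_, ⟨s, hs, rfl⟩, h₁, h₂, rfl⟩
      exact ⟨_, (ih _).2 ⟨s, hs, h₁, h₂, rfl⟩, fun _ => rfl⟩
  | @product U V hUV q r ihq ihr =>
    simp only [PosQuery.eval, Set.mem_ofPred_eq, sols, List.mem_flatMap, List.mem_map]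
    constructor
    · rintro ⟨hq, hr⟩
      obtain ⟨s, hs, h₁, h₂, h₃⟩ := (ihq _).1 hq
      obtain ⟨s', hs', h₁', h₂', h₃'⟩ := (ihr _).1 hr
      refine ⟨_, ⟨s, hs, s', hs', rfl⟩, fun x hx => (List.mem_append.1 hx).elim (h₁ x) (h₁' x),
        fun x hx => (List.mem_append.1 hx).elim (h₂ x) (h₂' x), ?_⟩
      funext a
      by_cases ha : a.1 ∈ U
      · simp only [unionTuple, ha, dite_true]
        exact congrFun h₃ ⟨a.1, ha⟩
      · simp only [unionTuple, ha, dite_false]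
        exact congrFun h₃' ⟨a.1, (Finset.mem_union.1 a.2).resolve_left ha⟩
    · rintro ⟨_, ⟨s, hs, s', hs', rfl⟩, h₁, h₂, rfl⟩
      refine ⟨(ihq _).2 ⟨s, hs, fun x hx => h₁ x (List.mem_append_left _ hx),
        fun x hx => h₂ x (List.mem_append_left _ hx), ?_⟩,
        (ihr _).2 ⟨s', hs', fun x hx => h₁ x (List.mem_append_right _ hx),
        fun x hx => h₂ x (List.mem_append_right _ hx), ?_⟩⟩
      · funext a
        simp [unionTuple]
      · funext a
        -- `unionTuple` prefers its left argument; disjointness ensures that no attribute of the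
        -- right factor is overridden.
        simp [unionTuple, Finset.disjoint_right.1 hUV a.2]
  | union q r ihq ihr =>
    simp only [PosQuery.eval, Set.mem_union, ihq, ihr, sols, List.mem_append, or_and_right,
      exists_or]
  | rename f q ih =>
    simp only [PosQuery.eval, Set.mem_ofPred_eq, sols, List.mem_map]
    constructor
    · intro ht
      obtain ⟨s, hs, h₁, h₂, h₃⟩ := (ih _).1 ht
      refine ⟨_, ⟨s, hs, rfl⟩, h₁, h₂, ?_⟩
      funext b
      simpa using congrFun h₃ (f.symm b)
    · rintro ⟨_, ⟨s, hs, rfl⟩, h₁, h₂, rfl⟩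
      exact (ih _).2 ⟨s, hs, h₁, h₂, by simp⟩

def rawComp (C : Component S D X) : RawComp S D X := (List.ofFn C.field, C.rows.map List.ofFn)

theorem mem_zip_ofFn {V V' : Type} {n : ℕ} {f : Fin n → V} {g : Fin n → V'} {z : V × V'} :
    z ∈ (List.ofFn f).zip (List.ofFn g) ↔ ∃ j, z = (f j, g j) := by
  have : (List.ofFn f).zip (List.ofFn g) = List.ofFn fun j => (f j, g j) := by
    apply List.ext_getElem <;> simp
  rw [this, List.mem_ofFn]
  simp [eq_comm]

theorem mem_fieldTerms {C : Component S D X} {r : Fin C.width → Cell D X} {f : Field S}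
    {x : Term D X} :
    x ∈ fieldTerms (rawComp C) (List.ofFn r) f ↔ ∃ j, C.field j = f ∧ r j = some x := by
  simp only [fieldTerms, rawComp, List.mem_flatMap, mem_zip_ofFn]
  constructor
  · rintro ⟨_, ⟨j, rfl⟩, hx⟩
    by_cases hj : C.field j = f
    · rw [show eqb (C.field j, r j).1 f = true by simpa using hj, cond_true] at hx
      exact ⟨j, hj, by simpa using hx⟩
    · rw [show eqb (C.field j, r j).1 f = false by simpa using hj, cond_false] at hx
      simp at hx
  · rintro ⟨j, rfl, hj⟩
    refine ⟨_, ⟨j, rfl⟩, ?_⟩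
    rw [show eqb (C.field j, r j).1 (C.field j) = true by simp, cond_true]
    simpa using hj

theorem mem_relSols {x₀ : Term D X} {i : Fin S.numRels} {cs : List (RawComp S D X)}
    {s : Sol S D X (S.attrs i)} : s ∈ relSols x₀ i cs ↔
      ∃ C ∈ cs, ∃ r ∈ C.2, ∃ f ∈ C.1, f.rel = i ∧ s = tupleSol x₀ i C r f := by
  simp only [relSols, List.mem_flatMap]
  refine exists_congr fun C => and_congr_right fun _ => exists_congr fun r =>
    and_congr_right fun _ => exists_congr fun f => and_congr_right fun _ => ?_
  by_cases h : f.rel = i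
  · rw [show eqb f.rel i = true by simpa using h, cond_true]
    simp [h]
  · rw [show eqb f.rel i = false by simpa using h, cond_false]
    simp [h]

/-- Some attribute exists and locates the component of the tuple. By `tupleLevel` all its other
fields lie there too, so one row determines the whole tuple. Conversely, the required entries alone
place the symbolic tuple in the world. -/
theorem mem_worldDB_iff {W : GWSD S D X} {ω : Field S → Cell D X} (hω : Picks W ω) (ν : X → D)
    (x₀ : Term D X) (i : Fin S.numRels) (t : Tuple D (S.attrs i)) :
    t ∈ worldDB ω ν i ↔ ∃ s ∈ relSols x₀ i (W.comps.map rawComp), Realizes ω ν s t := by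
  constructor
  · rintro ⟨d, s, hs, rfl⟩
    obtain ⟨a₀, ha₀⟩ := S.attrs_nonempty i
    obtain ⟨C, hC, hf⟩ := hω.2 ⟨i, d, ⟨a₀, ha₀⟩⟩ (by rw [hs]; simp)
    obtain ⟨r, hr, hrω⟩ := hω.1 C hC
    -- Every element of this list equals the entry of `ω` in the field, so taking its head loses
    -- nothing.
    have hτ : ∀ A, (fieldTerms (rawComp C) (List.ofFn r) ⟨i, d, A⟩).head?.getD x₀ = s A := by
      intro A
      obtain ⟨j, hj⟩ := W.tupleLevel C hC i d ⟨a₀, ha₀⟩ A hf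
      have hmem : s A ∈ fieldTerms (rawComp C) (List.ofFn r) ⟨i, d, A⟩ :=
        mem_fieldTerms.2 ⟨j, hj, by rw [← hrω, hj, hs]⟩
      obtain ⟨x, l, hl⟩ := List.exists_cons_of_ne_nil (List.ne_nil_of_mem hmem)
      obtain ⟨j', hj', hx⟩ := mem_fieldTerms.1 (hl ▸ List.mem_cons_self :
        x ∈ fieldTerms (rawComp C) (List.ofFn r) ⟨i, d, A⟩)
      rw [← hrω, hj', hs] at hx
      rw [hl, List.head?_cons, Option.getD_some]
      exact (Option.some.inj hx).symm
    refine ⟨_, mem_relSols.2 ⟨rawComp C, List.mem_map_of_mem hC, List.ofFn r,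
      List.mem_map_of_mem hr, ⟨i, d, ⟨a₀, ha₀⟩⟩, ?_, rfl, rfl⟩, ?_, ?_, ?_⟩
    · obtain ⟨j, hj⟩ := hf
      exact List.mem_ofFn.2 ⟨j, hj⟩
    · intro p hp
      obtain ⟨A, -, rfl⟩ := List.mem_map.1 hp
      simp only [hτ, hs]
    · simp [tupleSol]
    · simp only [tupleSol, hτ]
  · rintro ⟨s, hs, h₁, -, rfl⟩
    obtain ⟨C, -, r, -, f, -, -, rfl⟩ := mem_relSols.1 hs
    exact ⟨f.tid, _, fun A => h₁ _ (List.mem_map.2 ⟨A, by simp, rfl⟩), rfl⟩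

theorem compat_iff {W : GWSD S D X} {asg : List (Field S × Term D X)} :
    compat (W.comps.map rawComp) asg = true ↔ ∀ C ∈ W.comps, ∃ r ∈ C.rows, ∀ j, ∀ p ∈ asg,
      p.1 = C.field j → r j = some p.2 := by
  simp only [compat, List.all_map, List.all_eq_true, List.any_eq_true, Function.comp_apply,
    Bool.or_eq_true, Bool.not_eq_true', eqb_iff, eqb_false_iff]
  refine forall₂_congr fun C _ => ?_
  simp only [rawComp, List.mem_map, exists_exists_and_eq_and]
  refine exists_congr fun r => and_congr_right fun _ => ?_
  simp only [mem_zip_ofFn, forall_exists_index, forall_eq_apply_imp_iff, ← imp_iff_not_or]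
  exact forall_congr' fun j => forall₂_congr fun p _ => imp_congr_right fun _ => eq_comm

theorem covered_iff {W : GWSD S D X} {asg : List (Field S × Term D X)} :
    covered (W.comps.map rawComp) asg = true ↔ ∀ p ∈ asg, ∃ C ∈ W.comps, p.1 ∈ C.schema := by
  simp only [covered, List.any_map, List.all_eq_true, List.any_eq_true, Function.comp_apply,
    eqb_iff, rawComp, List.mem_ofFn, Component.schema, Set.mem_range]
  simp

/-- Disjoint schemas make the row choices independent, so fitting rows found separately glue to one
`ω`. `covered` is needed besides `compat`, which says nothing about fields occurring in no
component; there `ω` is `⊥`. -/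
theorem exists_picks_iff {W : GWSD S D X} {asg : List (Field S × Term D X)} :
    (∃ ω, Picks W ω ∧ ∀ p ∈ asg, ω p.1 = some p.2) ↔
      covered (W.comps.map rawComp) asg = true ∧ compat (W.comps.map rawComp) asg = true := by
  rw [compat_iff, covered_iff]
  constructor
  · rintro ⟨ω, ⟨h₁, h₂⟩, h₃⟩
    refine ⟨fun p hp => h₂ _ (by rw [h₃ p hp]; simp), fun C hC => ?_⟩
    obtain ⟨r, hr, h⟩ := h₁ C hC
    exact ⟨r, hr, fun j p hp e => by rw [← h, ← e, h₃ p hp]⟩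
  · rintro ⟨h₁, h₂⟩
    choose! ρ hρ h₂ using h₂
    classical
    let ω : Field S → Cell D X := fun f =>
      if h : ∃ C ∈ W.comps, ∃ j, C.field j = f then
        ρ h.choose h.choose_spec.2.choose else none
    have hω : ∀ C ∈ W.comps, ∀ j, ω (C.field j) = ρ C j := by
      intro C hC j
      have h : ∃ C' ∈ W.comps, ∃ j', C'.field j' = C.field j := ⟨C, hC, j, rfl⟩
      simp only [ω, dif_pos h]
      have hj := h.choose_spec.2.choose_spec
      have hC' := h.choose_spec.1
      generalize h.choose_spec.2.choose = j' at *
      generalize h.choose = C' at *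
      -- Components that share a field coincide, so the arbitrary choice hidden in `ω` does not
      -- matter.
      obtain rfl : C' = C := by
        by_contra hne
        have : Std.Symm fun C C' : Component S D X => Disjoint C.schema C'.schema :=
          ⟨fun _ _ h => h.symm⟩
        have hd := W.disjoint.forall hC' hC hne
        exact Set.disjoint_left.1 hd ⟨j', hj⟩ ⟨j, rfl⟩
      rw [C'.field_injective hj]
    refine ⟨ω, ⟨fun C hC => ⟨ρ C, hρ C hC, hω C hC⟩, fun f hf => ?_⟩, fun p hp => ?_⟩
    · by_contra h
      exact hf (dif_neg h)
    · obtain ⟨C, hC, j, hj⟩ := h₁ p hp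
      rw [← hj, hω C hC]
      exact h₂ C hC j p hp hj.symm

def rawLit : Literal D X → RawLit D X
  | .eq a b => (true, a, b)
  | .ne a b => (false, a, b)

theorem holds_iff (ls : List (Literal D X)) (ν : X → D) : (∀ l ∈ ls, l.Holds ν) ↔
    (∀ p ∈ litsWith true (ls.map rawLit), p.1.eval ν = p.2.eval ν) ∧
      ∀ p ∈ litsWith false (ls.map rawLit), p.1.eval ν ≠ p.2.eval ν := by
  simp only [litsWith, List.mem_flatMap, List.mem_map, exists_exists_and_eq_and]
  constructor
  · intro h
    refine ⟨?_, ?_⟩ <;> rintro p ⟨l, hl, hp⟩ <;> cases l <;> simp [rawLit] at hp <;> subst hp <;>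
      exact h _ hl
  · rintro ⟨h₁, h₂⟩ (⟨a, b⟩ | ⟨a, b⟩) hl
    · exact h₁ (a, b) ⟨_, hl, by simp [rawLit]⟩
    · exact h₂ (a, b) ⟨_, hl, by simp [rawLit]⟩

theorem zip_tupleList_iff {U : Finset ℕ} (τ : U → Term D X) (t : Tuple D U) (ν : X → D) :
    (∀ p ∈ (tupleList τ).zip (tupleList fun A => (Term.const (t A) : Term D X)),
      p.1.eval ν = p.2.eval ν) ↔ t = fun A => (τ A).eval ν := by
  simp only [tupleList, mem_zip_ofFn, forall_exists_index, forall_eq_apply_imp_iff]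
  constructor
  · intro h
    funext A
    obtain ⟨j, rfl⟩ := (U.orderIsoOfFin rfl).surjective A
    exact (h j).symm
  · rintro rfl j
    rfl

/-- Once the symbolic answer `s` is fixed, the conditions on `ω` and on `ν` share no unknown. The
joint existential quantifier then splits into `exists_picks_iff` and `sat_iff`. -/
theorem decideRaw_iff [Infinite D] (x₀ : Term D X) {U : Finset ℕ} (q : PosQuery S D U)
    (W : GWSD S D X) (t : Tuple D U) :
    decideRaw x₀ q (W.comps.map rawComp, W.cond.map rawLit,
      tupleList fun A => (Term.const (t A) : Term D X)) = true ↔ TupleQPossible q W t := by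
  simp only [decideRaw, List.any_eq_true, Bool.and_eq_true, ← exists_picks_iff, sat_iff]
  rw [TupleQPossible, exists_mem_rep_iff W (fun A => t ∈ q.eval A)]
  constructor
  · rintro ⟨s, hs, ⟨ω, hω, h₁⟩, ν, h₂, h₃⟩
    simp only [List.mem_append, or_imp, forall_and] at h₂
    exact ⟨ω, ν, hω, (holds_iff _ _).2 ⟨h₂.1.1, h₃⟩, (mem_eval_iff (mem_worldDB_iff hω ν x₀) q t).2
      ⟨s, hs, h₁, h₂.1.2, (zip_tupleList_iff _ _ _).1 h₂.2⟩⟩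
  · rintro ⟨ω, ν, hω, hν, ht⟩
    obtain ⟨s, hs, h₁, h₂, h₃⟩ := (mem_eval_iff (mem_worldDB_iff hω ν x₀) q t).1 ht
    refine ⟨s, hs, ⟨ω, hω, h₁⟩, ν, ?_, ((holds_iff _ _).1 hν).2⟩
    simp only [List.mem_append, or_imp, forall_and]
    exact ⟨⟨((holds_iff _ _).1 hν).1, h₂⟩, (zip_tupleList_iff _ _ _).2 h₃⟩

end Correctness

/-! ### Parsing the input word -/

def symIndex : Sym → Fin 14
  | .bit false => 0
  | .bit true => 1
  | .const => 2
  | .var => 3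
  | .bot => 4
  | .rel => 5
  | .tid => 6
  | .attr => 7
  | .comp => 8
  | .row => 9
  | .cond => 10
  | .eq => 11
  | .ne => 12
  | .tuple => 13

theorem symIndex_injective : Function.Injective symIndex := by
  intro a b h
  rcases a with ⟨_ | _⟩ | _ <;> rcases b with ⟨_ | _⟩ | _ <;>
    first | rfl | exact absurd h (by decide)

noncomputable instance : Fintype Sym := Fintype.ofInjective _ symIndex_injective

instance : Coded Sym := ⟨fun c => code (symIndex c)⟩

instance : CodeInj Sym := ⟨fun _ _ h => symIndex_injective (CodeInj.inj h)⟩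

/-- A constant or a variable, written as bits. -/
abbrev BitTerm : Type := Bool × List Bool

abbrev BitCell : Type := Option BitTerm

abbrev BitField : Type := List Bool × List Bool × List Bool

abbrev BitComp : Type := List BitField × List (List BitCell)

abbrev BitInput : Type := List BitComp × List (Bool × List BitCell) × List BitCell

/-- The state of the parser, which reads the word from right to left: the bits, the attribute and
the tuple identifier read last; the cells, fields and rows that are not yet part of a larger unit;
and the finished part of the input. -/
abbrev ParseState : Type :=
  (List Bool × List Bool × List Bool) × (List BitCell × List BitField × List (List BitCell)) ×
    BitInput

/-- Every marker stands before the material it governs. Reading from right to left, the marker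
arrives when that material is complete, so no lookahead is needed. `cond` may be ignored, as each
literal is already closed by its own marker. -/
def parseStep : Sym → ParseState → ParseState
  | .bit b, s => ((b :: s.1.1, s.1.2), s.2)
  | .const, s => (([], s.1.2), (some (true, s.1.1) :: s.2.1.1, s.2.1.2), s.2.2)
  | .var, s => (([], s.1.2), (some (false, s.1.1) :: s.2.1.1, s.2.1.2), s.2.2)
  | .bot, s => (s.1, (none :: s.2.1.1, s.2.1.2), s.2.2)
  | .attr, s => (([], s.1.1, s.1.2.2), s.2)
  | .tid, s => (([], s.1.2.1, s.1.1), s.2)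
  | .rel, s => (([], [], []),
      (s.2.1.1, (s.1.1, s.1.2.2, s.1.2.1) :: s.2.1.2.1, s.2.1.2.2), s.2.2)
  | .row, s => (s.1, ([], s.2.1.2.1, s.2.1.1 :: s.2.1.2.2), s.2.2)
  | .comp, s => (s.1, ([], [], []), ((s.2.1.2.1, s.2.1.2.2) :: s.2.2.1, s.2.2.2))
  | .eq, s => (s.1, ([], s.2.1.2), (s.2.2.1, (true, s.2.1.1) :: s.2.2.2.1, s.2.2.2.2))
  | .ne, s => (s.1, ([], s.2.1.2), (s.2.2.1, (false, s.2.1.1) :: s.2.2.2.1, s.2.2.2.2))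
  | .cond, s => s
  | .tuple, s => (s.1, ([], s.2.1.2), (s.2.2.1, s.2.2.2.1, s.2.1.1))

def parseInit : ParseState := (([], [], []), ([], [], []), [], [], [])

/-- The input given by a word in reverse. -/
def parse (w : List Sym) : BitInput := (w.foldl (fun s c => parseStep c s) parseInit).2.2

/-- Markers move parts of the state without copying them, so the growth per symbol is bounded by a
constant, as `Poly.foldl` needs. -/
theorem csize_parseStep_le (c : Sym) (s : ParseState) : csize (parseStep c s) ≤ csize s + 20 := by
  obtain ⟨⟨b, a, t⟩, ⟨cells, fields, rows⟩, comps, lits, tup⟩ := s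
  have h₁ := csize_pos b
  have h₂ := csize_pos a
  have h₃ := csize_pos t
  have h₄ := csize_pos cells
  have h₅ := csize_pos fields
  have h₆ := csize_pos rows
  have h₇ := csize_pos tup
  have h₈ := csize_bool true
  have h₉ := csize_bool false
  rcases c with (_ | _) | _ <;> simp [parseStep] <;> omega

theorem Poly.parseStep (c : Sym) : Poly (parseStep c) := by
  rcases c with b | _ <;> unfold StackFlow.parseStep <;> fun_prop

theorem Poly.parse : Poly parse := by
  have h : Poly (fun p : List Sym × ParseState × Sym => StackFlow.parseStep p.2.2 p.2.1) :=
    Poly.finite_cases (c := fun p : List Sym × ParseState × Sym => p.2.2)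
      (g := fun c p => StackFlow.parseStep c p.2.1) (by fun_prop)
      fun c => (Poly.parseStep c).comp (by fun_prop)
  exact (Poly.foldl (h := fun _ s c => StackFlow.parseStep c s) Poly.id (Poly.const parseInit) h 20
    fun a s c _ => (csize_parseStep_le c s).trans (by simp)).snd'.snd'

/-- The terms of the cells, which are assumed not to be empty. -/
def cellTerm (c : BitCell) : BitTerm := c.getD (true, [])

/-- The defaults never arise on encoded inputs, where each literal has exactly two cells, neither of
them `⊥`. -/
def BitInput.toTerms (x : BitInput) :
    List BitComp × List (Bool × BitTerm × BitTerm) × List BitTerm :=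
  (x.1, x.2.1.map fun l => (l.1, cellTerm (l.2[0]?.getD none), cellTerm (l.2[1]?.getD none)),
    x.2.2.map cellTerm)

theorem Poly.toTerms : Poly BitInput.toTerms := by
  have hc : Poly cellTerm := Poly.id.getD (Poly.const _)
  refine .prodMk (by fun_prop) (.prodMk ?_ ?_)
  · exact Poly.map (g := fun _ (l : Bool × List BitCell) =>
      (l.1, cellTerm (l.2[0]?.getD none), cellTerm (l.2[1]?.getD none))) (by fun_prop)
      (by fun_prop)
  · exact Poly.map (g := fun _ => cellTerm) (by fun_prop) (by fun_prop)

/-! ### The parser recovers the gWSD and the tuple. -/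

section Correctness

variable {S : RelSchema} {D X : Type} (encD : D → List Bool) (encX : X → List Bool)

def bitTerm : Term D X → BitTerm
  | .const c => (true, encD c)
  | .var x => (false, encX x)

def bitCell (c : Cell D X) : BitCell := c.map (bitTerm encD encX)

def bitField (f : Field S) : BitField :=
  (Computability.encodeNat f.rel, Computability.encodeNat f.tid, Computability.encodeNat f.attr)

def bitComp (C : RawComp S D X) : BitComp :=
  (C.1.map bitField, C.2.map fun r => r.map (bitCell encD encX))

def bitLit : Literal D X → Bool × List BitCell
  | .eq a b => (true, [some (bitTerm encD encX a), some (bitTerm encD encX b)])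
  | .ne a b => (false, [some (bitTerm encD encX a), some (bitTerm encD encX b)])

/-- The state of the parser after reading the word `w` from right to left. -/
abbrev parseFrom (w : List Sym) (s : ParseState) : ParseState := w.foldr parseStep s

theorem parseFrom_append (w w' : List Sym) (s : ParseState) :
    parseFrom (w ++ w') s = parseFrom w (parseFrom w' s) :=
  List.foldr_append

theorem parseFrom_bits (l b : List Bool) (x : List Bool × List Bool)
    (y : (List BitCell × List BitField × List (List BitCell)) × BitInput) :
    parseFrom (encodeBits l) ((b, x), y) = ((l ++ b, x), y) := by
  induction l with
  | nil => rfl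
  | cons a l ih =>
    have : parseFrom (encodeBits (a :: l)) ((b, x), y) =
      parseStep (.bit a) (parseFrom (encodeBits l) ((b, x), y)) := rfl
    rw [this, ih]
    rfl

variable {encD encX}

theorem parseFrom_term (a : Term D X) (x : List Bool × List Bool) (cells : List BitCell)
    (y : List BitField × List (List BitCell)) (z : BitInput) :
    parseFrom (encodeTerm encD encX a) (([], x), (cells, y), z) =
      (([], x), (some (bitTerm encD encX a) :: cells, y), z) := by
  cases a with
  | const c =>
    have : parseFrom (encodeTerm encD encX (.const c)) (([], x), (cells, y), z) =
      parseStep .const (parseFrom (encodeBits (encD c)) (([], x), (cells, y), z)) := rfl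
    rw [this, parseFrom_bits, List.append_nil]
    rfl
  | var c =>
    have : parseFrom (encodeTerm encD encX (.var c)) (([], x), (cells, y), z) =
      parseStep .var (parseFrom (encodeBits (encX c)) (([], x), (cells, y), z)) := rfl
    rw [this, parseFrom_bits, List.append_nil]
    rfl

theorem parseFrom_cells (l : List (Cell D X)) (x : List Bool × List Bool) (cells : List BitCell)
    (y : List BitField × List (List BitCell)) (z : BitInput) :
    parseFrom (l.map (encodeCell encD encX)).flatten (([], x), (cells, y), z) =
      (([], x), (l.map (bitCell encD encX) ++ cells, y), z) := by
  induction l with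
  | nil => rfl
  | cons c l ih =>
    rw [List.map_cons, List.flatten_cons, parseFrom_append, ih]
    cases c with
    | none => rfl
    | some a => exact parseFrom_term a _ _ _ _

theorem parseFrom_field (f : Field S) (cells : List BitCell) (fields : List BitField)
    (rows : List (List BitCell)) (z : BitInput) :
    parseFrom (encodeField f) (([], [], []), (cells, fields, rows), z) =
      (([], [], []), (cells, bitField f :: fields, rows), z) := by
  have : ∀ s, parseFrom (encodeField f) s =
      parseStep .rel (parseFrom (encodeNum f.rel) (parseStep .tid (parseFrom (encodeNum f.tid)
        (parseStep .attr (parseFrom (encodeNum f.attr) s))))) := fun s => by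
    simp [encodeField, parseFrom]
  rw [this]
  simp only [encodeNum, parseFrom_bits, parseStep, List.append_nil]
  rfl

theorem parseFrom_fields (l : List (Field S)) (cells : List BitCell) (fields : List BitField)
    (rows : List (List BitCell)) (z : BitInput) :
    parseFrom (l.map encodeField).flatten (([], [], []), (cells, fields, rows), z) =
      (([], [], []), (cells, l.map bitField ++ fields, rows), z) := by
  induction l with
  | nil => rfl
  | cons f l ih =>
    rw [List.map_cons, List.flatten_cons, parseFrom_append, ih]
    exact parseFrom_field f _ _ _ _

theorem parseFrom_rows (l : List (List (Cell D X))) (fields : List BitField)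
    (rows : List (List BitCell)) (z : BitInput) :
    parseFrom (l.flatMap fun r => Sym.row :: (r.map (encodeCell encD encX)).flatten)
        (([], [], []), ([], fields, rows), z) =
      (([], [], []), ([], fields, (l.map fun r => r.map (bitCell encD encX)) ++ rows), z) := by
  induction l with
  | nil => rfl
  | cons r l ih =>
    rw [List.flatMap_cons, parseFrom_append, ih]
    refine (congrArg (parseStep .row) (parseFrom_cells r _ _ _ _)).trans ?_
    rw [List.append_nil]
    rfl

theorem parseFrom_comp (C : Component S D X) (comps : List BitComp)
    (z : List (Bool × List BitCell) × List BitCell) :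
    parseFrom (encodeComponent encD encX C) (([], [], []), ([], [], []), comps, z) =
      (([], [], []), ([], [], []), bitComp encD encX (rawComp C) :: comps, z) := by
  have h : encodeComponent encD encX C = Sym.comp :: (((List.ofFn C.field).map encodeField).flatten ++
      (C.rows.map List.ofFn).flatMap fun r =>
        Sym.row :: (r.map (encodeCell encD encX)).flatten) := by
    simp only [encodeComponent, List.map_ofFn, List.flatMap_map, List.cons_append]
    rfl
  rw [h]
  refine (congrArg (parseStep .comp) ((parseFrom_append _ _ _).trans
    ((congrArg _ (parseFrom_rows _ _ _ _)).trans (parseFrom_fields _ _ _ _ _)))).trans ?_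
  rw [List.append_nil, List.append_nil]
  rfl

theorem parseFrom_comps (l : List (Component S D X)) (comps : List BitComp)
    (z : List (Bool × List BitCell) × List BitCell) :
    parseFrom (l.flatMap (encodeComponent encD encX)) (([], [], []), ([], [], []), comps, z) =
      (([], [], []), ([], [], []), (l.map fun C => bitComp encD encX (rawComp C)) ++ comps, z) := by
  induction l with
  | nil => rfl
  | cons C l ih =>
    rw [List.flatMap_cons, parseFrom_append, ih]
    exact parseFrom_comp C _ _

theorem parseFrom_lits (l : List (Literal D X)) (comps : List BitComp)
    (lits : List (Bool × List BitCell)) (tup : List BitCell) :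
    parseFrom (l.flatMap (encodeLiteral encD encX))
        (([], [], []), ([], [], []), comps, lits, tup) =
      (([], [], []), ([], [], []), comps, l.map (bitLit encD encX) ++ lits, tup) := by
  induction l with
  | nil => rfl
  | cons a l ih =>
    rw [List.flatMap_cons, parseFrom_append, ih]
    rcases a with ⟨a, b⟩ | ⟨a, b⟩
    · exact congrArg (parseStep .eq) ((parseFrom_append _ _ _).trans
        ((congrArg _ (parseFrom_term b _ _ _ _)).trans (parseFrom_term a _ _ _ _)))
    · exact congrArg (parseStep .ne) ((parseFrom_append _ _ _).trans
        ((congrArg _ (parseFrom_term b _ _ _ _)).trans (parseFrom_term a _ _ _ _)))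

theorem parseFrom_tuple {U : Finset ℕ} (t : Tuple D U) :
    parseFrom (encodeTuple encD t) parseInit =
      (([], [], []), ([], [], []), [], [],
        (tupleList fun A => (some (.const (t A)) : Cell D X)).map (bitCell encD encX)) := by
  have h : encodeTuple encD t = Sym.tuple ::
      ((tupleList fun A => (some (.const (t A)) : Cell D X)).map (encodeCell encD encX)).flatten := by
    simp only [encodeTuple, tupleList, List.map_ofFn]
    rfl
  rw [h]
  refine (congrArg (parseStep .tuple) (parseFrom_cells _ _ _ _ _)).trans ?_
  rw [List.append_nil]
  rfl

/-- A left fold over the reversed word is a right fold over the word, so each syntactic unit can be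
treated by its own `parseFrom` lemma. The reversed word is what loading the input stack produces. -/
theorem parse_encodeInput {U : Finset ℕ} (W : GWSD S D X) (t : Tuple D U) :
    parse (encodeInput encD encX (W, t)).reverse =
      (W.comps.map fun C => bitComp encD encX (rawComp C), W.cond.map (bitLit encD encX),
        (tupleList fun A => (some (.const (t A)) : Cell D X)).map (bitCell encD encX)) := by
  have h : (encodeInput encD encX (W, t)).reverse.foldl (fun s c => parseStep c s) parseInit =
      parseFrom (encodeInput encD encX (W, t)) parseInit := List.foldl_reverse
  rw [parse, h, encodeInput, parseFrom_append, parseFrom_tuple (encX := encX), encodeGWSD,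
    parseFrom_append]
  have h₂ : ∀ s, parseFrom (Sym.cond :: W.cond.flatMap (encodeLiteral encD encX)) s =
    parseFrom (W.cond.flatMap (encodeLiteral encD encX)) s := fun _ => rfl
  rw [h₂, parseFrom_lits, parseFrom_comps, List.append_nil, List.append_nil]

theorem toTerms_parse_encodeInput {U : Finset ℕ} (W : GWSD S D X) (t : Tuple D U) :
    (parse (encodeInput encD encX (W, t)).reverse).toTerms =
      ((W.comps.map rawComp).map (bitComp encD encX),
        (W.cond.map rawLit).map (fun l => (l.1, bitTerm encD encX l.2.1, bitTerm encD encX l.2.2)),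
        (tupleList fun A => (.const (t A) : Term D X)).map (bitTerm encD encX)) := by
  rw [parse_encodeInput, BitInput.toTerms]
  simp only [List.map_map, tupleList, List.map_ofFn]
  congr 2
  refine List.map_congr_left fun l _ => ?_
  cases l <;> rfl

end Correctness

/-! ### From coded functions to Turing machines -/

section Machine

open Turing

variable {Γ₀ : Type} [Fintype Γ₀]

/-- Replace the code of a truth value by the truth value. -/
def unloadBool (Γ₀ : Type) [Fintype Γ₀] : Flow (Alph Γ₀) :=
  Flow.branch (Γ := Alph Γ₀) (some .main) fun o =>
    if o = some true then
      Flow.branch (Γ := Alph Γ₀) (some .main) fun _ => Flow.branch (Γ := Alph Γ₀) (some .main)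
        fun _ => Flow.push (Γ := Alph Γ₀) (some .main) true
    else Flow.push (Γ := Alph Γ₀) (some .main) false

theorem unloadBool_run (b : Bool) :
    (unloadBool Γ₀).Run (ready Γ₀ (code b).enc) 4 (ready Γ₀ [b]) := by
  cases b
  · refine (branch_main_run (t := 1) ?_).mono (by omega)
    exact push_main_run false
  · refine branch_main_run (t := 3) ?_
    exact branch_main_run (branch_main_run (push_main_run true))

variable [Coded Γ₀]

/-- Move the input word to the main stack, as the code of the reversed word. -/
def loadLoop (Γ₀ : Type) [Fintype Γ₀] [Coded Γ₀] : Flow (Alph Γ₀) :=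
  Flow.loop (Γ := Alph Γ₀) none Option.isSome fun o =>
    o.elim (Flow.skip _) fun c => pushBits (true :: (code c).enc)

theorem loadLoop_run {K : ℕ} (hK : ∀ c : Γ₀, csize c ≤ K) (w l : List Γ₀) :
    (loadLoop Γ₀).Run (st w true (code l).enc [] [] []) (w.length * (K + 3) + 1)
      (st [] true (code (w.reverse ++ l)).enc [] [] []) := by
  induction w generalizing l with
  | nil => exact (Flow.loop_exit (by simp)).congr (by simp) (by simp)
  | cons c w ih =>
    have h₁ := pushBits_run (Γ₀ := Γ₀) (i := w) (k := true) (m := (code l).enc) (x := []) (y := [])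
      (c := []) (true :: (code c).enc)
    have h₂ : (loadLoop Γ₀).Run
        (st w true (true :: (code c).enc ++ (code l).enc) [] [] []) _ _ := ih (c :: l)
    refine (Flow.Run.loop (by simp) ?_ h₂).congr (t := (true :: (code c).enc).length + 1 +
      (w.length * (K + 3) + 1) + 1) ?_ (by simp)
    · rw [st_inp, update_st_inp]
      exact h₁
    · have := hK c
      simp only [csize] at this
      simp [add_mul]
      omega

/-- Hypothesis `he` makes the code of an input that of its reversed word. Loading can thus simply
move symbols onto the main stack, and all parsing is left to `f`. -/
theorem inPTIME_of_poly {α : Type} [Coded α] {e : α → List Γ₀}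
    (he : ∀ a : α, code a = code (e a).reverse) {f : α → Bool} (hf : Poly f) {P : α → Prop}
    (hP : ∀ a, f a = true ↔ P a) : InPTIME e P := by
  obtain ⟨F, p, hF⟩ := hf Γ₀
  obtain ⟨K, hK⟩ := Finite.exists_le (fun c : Γ₀ => csize c)
  let M : Flow (Alph Γ₀) := (Flow.push (Γ := Alph Γ₀) (some .main) false).seq
    ((loadLoop Γ₀).seq (F.seq (unloadBool Γ₀)))
  -- With input length n, loading takes n(K+3)+1 steps and yields a code of size at most n(K+1)+1.
  -- The initial push and the unloading add 1 and 4.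
  let q : Polynomial ℕ := Polynomial.X * (Polynomial.C K + 3) + 6 +
    p.comp (Polynomial.X * (Polynomial.C K + 1) + 1)
  have hsize : ∀ w : List Γ₀, csize w ≤ w.length * (K + 1) + 1 := by
    intro w
    induction w with
    | nil => simp
    | cons c w ih =>
      have := hK c
      simp [add_mul] at ih ⊢
      omega
  have hrun : ∀ a, M.Run (st (e a) true [] [] [] []) (q.eval (e a).length)
      (st [] true [f a] [] [] []) := by
    intro a
    have h₁ := loadLoop_run hK (e a) []
    have h₂ := (hF a).2 []
    rw [List.append_nil] at h₁ h₂
    rw [← he] at h₁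
    rw [List.append_nil] at h₂
    have h₃ := eval_mono p (m := csize a) (n := (e a).length * (K + 1) + 1) (by
      have := hsize (e a).reverse
      rw [List.length_reverse] at this
      rwa [csize, he])
    refine ((push_main_run false).seq (h₁.seq (h₂.seq (unloadBool_run (f a))))).mono ?_
    simp [q]
    omega
  refine ⟨f, hP, ⟨{ tm := M.toTM none (some .main)
                    inputAlphabet := Equiv.refl Γ₀
                    outputAlphabet := Equiv.refl Bool
                    time := q
                    outputsFun := fun a => Classical.choice ?_ }⟩⟩
  obtain ⟨n, hn, h⟩ := (hrun a).toTM M none (some .main) rfl none (by simp)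
  have hinit : initList (M.toTM none (some .main)) ((e a).map (Equiv.refl Γ₀).invFun) =
      (⟨some M.start, none, st (e a) true [] [] [] []⟩ :
        TM2.Cfg (Alph Γ₀) M.Λ (Option M.Λ)) := by
    have : (e a).map (Equiv.refl Γ₀).invFun = e a := List.map_id _
    rw [this]
    unfold initList
    congr 1
    funext k
    rcases k with _ | _ | k' | _ <;> simp [st]
  have hhalt : haltList (M.toTM none (some .main))
      ((Computability.encodeBool (f a)).map (Equiv.refl Bool).invFun) =
      (⟨none, none, st [] true [f a] [] [] []⟩ : TM2.Cfg (Alph Γ₀) M.Λ (Option M.Λ)) := by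
    have : (Computability.encodeBool (f a)).map (Equiv.refl Bool).invFun = [f a] := rfl
    rw [this]
    unfold haltList
    congr 1
    funext k
    rcases k with _ | _ | k' | _ <;> simp [st]
  refine ⟨⟨⟨n, ?_⟩, hn⟩⟩
  rw [hinit, Option.map_some, hhalt]
  exact h

end Machine

theorem code_map {α β : Type} [Coded α] [Coded β] {g : α → β} (h : ∀ a, code (g a) = code a)
    (l : List α) : code (l.map g) = code l := by
  induction l with
  | nil => rfl
  | cons a l ih => rw [List.map_cons, code_cons, code_cons, h, ih]

theorem tupleQPossible_inPTIME {D X : Type} [Infinite D] (encD : D → List Bool)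
    (hencD : Function.Injective encD) (encX : X → List Bool) (hencX : Function.Injective encX)
    (S : RelSchema) (U : Finset ℕ) (q : PosQuery S D U) :
    InPTIME (encodeInput encD encX)
      (fun p : GWSD S D X × Tuple D U => TupleQPossible q p.1 p.2) := by
  let : Coded D := ⟨fun d => code (encD d)⟩
  let : Coded X := ⟨fun x => code (encX x)⟩
  -- The input is coded as the bare word, whereas `D` and `X` are coded by their bit strings. Parsed
  -- bit strings and the abstract objects they denote then have identical codes, so the parser
  -- literally computes `raw`.
  let : Coded (GWSD S D X × Tuple D U) := ⟨fun p => code (encodeInput encD encX p).reverse⟩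
  have : CodeInj D := ⟨fun _ _ h => hencD (CodeInj.inj h)⟩
  have : CodeInj X := ⟨fun _ _ h => hencX (CodeInj.inj h)⟩
  let raw : GWSD S D X × Tuple D U →
      List (RawComp S D X) × List (RawLit D X) × List (Term D X) := fun p =>
    (p.1.comps.map rawComp, p.1.cond.map rawLit, tupleList fun A => (.const (p.2 A) : Term D X))
  have hterm : ∀ t : Term D X, code (bitTerm encD encX t) = code t := by
    rintro (_ | _) <;> rfl
  have hcell : ∀ c : Cell D X, code (bitCell encD encX c) = code c := by
    rintro (_ | t)
    · rfl
    · exact congrArg (fun d => Dat.node d .nil) (hterm t)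
  have hcomp : ∀ C : RawComp S D X, code (bitComp encD encX C) = code C := fun C =>
    congrArg₂ Dat.node (code_map (g := bitField) (fun _ => rfl) _)
      (code_map (g := List.map (bitCell encD encX)) (code_map hcell) _)
  have hlit : ∀ l : RawLit D X,
      code (l.1, bitTerm encD encX l.2.1, bitTerm encD encX l.2.2) = code l := fun l =>
    congrArg (Dat.node _) (congrArg₂ Dat.node (hterm _) (hterm _))
  have hraw : Poly raw := by
    refine (Poly.toTerms.comp Poly.parse).of_code (fun p => (encodeInput encD encX p).reverse)
      (fun _ => rfl) fun p => ?_
    rw [toTerms_parse_encodeInput]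
    exact (congrArg₂ Dat.node (code_map hcomp _)
      (congrArg₂ Dat.node (code_map hlit _) (code_map hterm _))).symm
  -- Any constant serves as the default term for `⊥` in `tupleSol`.
  obtain ⟨d₀⟩ : Nonempty D := inferInstance
  exact inPTIME_of_poly (fun _ => rfl) ((Poly.decideRaw (.const d₀) q).comp hraw)
    fun p => decideRaw_iff (.const d₀) q p.1 p.2

end StackFlow

open IncompleteDB
theorem mainTheorem6 {D X : Type} [Infinite D]
    (encD : D → List Bool) (hencD : Function.Injective encD)
    (encX : X → List Bool) (hencX : Function.Injective encX)
    (S : RelSchema) :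
    (∀ (U : Finset ℕ) (q : PosQuery S D U),
      InPTIME (encodeInput encD encX)
        (fun p : GWSD S D X × Tuple D U => TupleQPossible q p.1 p.2)) ∧
    (∀ i : Fin S.numRels,
      InPTIME (encodeInput encD encX)
        (fun p : GWSD S D X × Tuple D (S.attrs i) => TuplePossible i p.1 p.2)) :=
  ⟨StackFlow.tupleQPossible_inPTIME encD hencD encX hencX S, fun i =>
    -- Tuple possibility is, by definitional unfolding, the case of the query `R_i`.
    StackFlow.tupleQPossible_inPTIME encD hencD encX hencX S (S.attrs i) (.rel i)⟩
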